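/- Let $n\ge 0$ and let $Sp(2n)$ be the group of real $2n\times 2n$ matrices $S$ with $S^TJS=J$, $J=\begin{pmatrix}0&\mathbb 1_n\\-\mathbb 1_n&0\end{pmatrix}$, and $K(n)=Sp(2n)\cap O(2n)$. For a real $2n\times 2n$ matrix $A$ with singular values $s_1^{\downarrow}(A)\ge\dots\ge s_{2n}^{\downarrow}(A)$ put $F(A)=\sum_{i=1}^n\log s_i^{\downarrow}(A)$. Let $E_{ij}$ be the $n\times n$ matrix units. The passive generators $g^p$ are the matrices $\nu\begin{pmatrix}E_{ji}-E_{ij}&0\\0&E_{ji}-E_{ij}\end{pmatrix}$ $(i<j)$ and $\nu\begin{pmatrix}0&E_{ij}+E_{ji}\\-(E_{ij}+E_{ji})&0\end{pmatrix}$ $(i\le j)$, with arbitrary nonzero real normalisation factors $\nu$ (one for each generator). The active generators $g^a$ are $\tfrac12\begin{pmatrix}E_{ij}+E_{ji}&0\\0&-(E_{ij}+E_{ji})\end{pmatrix}$ and $\tfrac12\begin{pmatrix}0&E_{ij}+E_{ji}\\E_{ij}+E_{ji}&0\end{pmatrix}$ $(i\le j)$, which are normalised so that $F(\exp(cg))=|c|$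 for $c\in\mathbb R$. Together the generators form a basis of the Lie algebra $\mathfrak{sp}(2n)$. For $S\in Sp(2n)$ let $\mathcal C^r(S)$ be the set of absolutely continuous curves $\alpha:[0,1]\to Sp(2n)$ with $\alpha(0)=\mathbb 1$, $\alpha(1)=S$ whose derivative is bounded almost everywhere. For such a curve write, for almost every $t$, $\dot\alpha(t)=\sum_k c^p_k(t)\,g^p_k(\alpha(t))+\sum_k c^a_k(t)\,g^a_k(\alpha(t))$, where $g(x)$ denotes the invariant vector field given by $g$ (either $g(x)=xg$ throughout, or $g(x)=gx$ throughout), and define $$\tilde F(S)=\inf\left\{\int_0^1\|c^a(t)\|_1\,dt\ \middle|\ \alpha\in\mathcal C^r(S)\right\},\qquad \|c^a(t)\|_1=\sum_k|c^a_k(t)|.$$ Then, for every $S\in Sp(2n)$ and with either convention for $g(x)$, $\tilde F(S)=F(S)$, and the infimum is attained. Moreover the Euler decomposition is squeezing-optimal: $S$ can be written as $S=L\,\mathrm{diag}(a_1,\dots,a_n,a_1^{-1},\dots,a_n^{-1})\,R$ with $L,R\in K(n)$ and all $a_i>0$, and for every such decomposition there is a curve in $\mathcal C^r(S)$ of cost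 exactly $F(S)$ which implements its factors one after the other, the three factors in three consecutive time intervals of length $1/3$: $L$, then the diagonal factor, then $R$ if $g(x)=xg$, and in the opposite order if $g(x)=gx$. It uses only passive generators for $L$ and $R$, and only the single-mode squeezing generators (first active family, $i=j$) for the diagonal factor. -/

import Mathlib

namespace Squeezing

open MeasureTheory Set Matrix

/-- Real `2n × 2n` matrices on phase space, in the ordering `(Q₁, …, Qₙ, P₁, …, Pₙ)`. -/
abbrev PhaseMatrix (n : ℕ) : Type := Matrix (Fin n ⊕ Fin n) (Fin n ⊕ Fin n) ℝ

/-- The real symplectic group `Sp(2n)`. -/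
abbrev Sp (n : ℕ) : Submonoid (PhaseMatrix n) := Matrix.symplecticGroup (Fin n) ℝ

/-- The maximal compact subgroup `K(n) = Sp(2n) ∩ O(2n)`. -/
def K (n : ℕ) : Set (PhaseMatrix n) :=
  {A | A ∈ Sp n ∧ A ∈ Matrix.orthogonalGroup (Fin n ⊕ Fin n) ℝ}

/-- The product of single-mode squeezers `diag(a₁, …, aₙ, a₁⁻¹, …, aₙ⁻¹)`. -/
noncomputable def squeezer {n : ℕ} (a : Fin n → ℝ) : PhaseMatrix n :=
  Matrix.fromBlocks (Matrix.diagonal a) 0 0 (Matrix.diagonal fun i => (a i)⁻¹)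

/-- `S = L · diag(a, a⁻¹) · R` with `L, R ∈ K(n)` and all `aᵢ > 0`. -/
structure IsEulerDecomposition {n : ℕ} (S L : PhaseMatrix n) (a : Fin n → ℝ)
    (R : PhaseMatrix n) : Prop where
  left_mem : L ∈ K n
  right_mem : R ∈ K n
  pos : ∀ i, 0 < a i
  eq : S = L * squeezer a * R

/-- `F(A) = ∑_{i=1}^{n} log sᵢ↓(A)`: the logarithms of the `n` largest of the `2n` singular values
(`LinearMap.singularValues` lists them in decreasing order with multiplicity, from index `0`). -/
noncomputable def F {n : ℕ} (A : PhaseMatrix n) : ℝ :=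
  ∑ i ∈ Finset.range n, Real.log ((Matrix.toEuclideanLin A).singularValues i)

/-- The symmetric matrix `E_{ij} + E_{ji}` (which is `2 E_{ii}` for `i = j`). -/
def symUnit {n : ℕ} (i j : Fin n) : Matrix (Fin n) (Fin n) ℝ :=
  Matrix.single i j 1 + Matrix.single j i 1

/-- The antisymmetric matrix `E_{ji} - E_{ij}`. -/
def skewUnit {n : ℕ} (i j : Fin n) : Matrix (Fin n) (Fin n) ℝ :=
  Matrix.single j i 1 - Matrix.single i j 1

/-- Index pairs `i ≤ j`. -/
abbrev Pairs (n : ℕ) : Type := {p : Fin n × Fin n // p.1 ≤ p.2}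

/-- Index pairs `i < j`. -/
abbrev StrictPairs (n : ℕ) : Type := {p : Fin n × Fin n // p.1 < p.2}

/-- Indices of the passive generators: one family over `i < j`, one over `i ≤ j`. -/
abbrev PassiveIndex (n : ℕ) : Type := StrictPairs n ⊕ Pairs n

/-- Indices of the active generators: two families over `i ≤ j`. -/
abbrev ActiveIndex (n : ℕ) : Type := Pairs n ⊕ Pairs n

/-- The passive generators, a basis of the Lie algebra of `K(n)`, before normalisation. They are
the matrices `J h`, `J = [[0, 1], [-1, 0]]`, for the quadratic Hamiltonians `½ Rᵀ h R` equal to `i(aⱼ†aᵢ - aᵢ†aⱼ)`, `i < j`,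
and to `aᵢ†aⱼ + aⱼ†aᵢ`, `i ≤ j` (up to additive constants). -/
def passiveGenerator {n : ℕ} : PassiveIndex n → PhaseMatrix n
  | Sum.inl p => Matrix.fromBlocks (skewUnit p.1.1 p.1.2) 0 0 (skewUnit p.1.1 p.1.2)
  | Sum.inr p => Matrix.fromBlocks 0 (symUnit p.1.1 p.1.2) (-symUnit p.1.1 p.1.2) 0

/-- The active generators, a basis of the symmetric part of the Lie algebra of `Sp(2n)`. Up to sign
they are the matrices `½ J h` for the quadratic Hamiltonians `½ Rᵀ h R` equal to
`i(aⱼ†aᵢ† - aᵢaⱼ)` and to `aᵢ†aⱼ† + aᵢaⱼ`, `i ≤ j`. The positive eigenvalues of each of them add up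
to `1` (a single eigenvalue `1` for `i = j`, a double eigenvalue `½` for `i < j`), so that
`F (exp (c g)) = |c|` for each generator `g` and each real `c`. For `i = j` the first family
generates the single-mode squeezers of mode `i`. -/
noncomputable def activeGenerator {n : ℕ} : ActiveIndex n → PhaseMatrix n
  | Sum.inl p =>
      (1 / 2 : ℝ) • Matrix.fromBlocks (symUnit p.1.1 p.1.2) 0 0 (-symUnit p.1.1 p.1.2)
  | Sum.inr p =>
      (1 / 2 : ℝ) • Matrix.fromBlocks 0 (symUnit p.1.1 p.1.2) (symUnit p.1.1 p.1.2) 0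

/-- The element `∑ₖ cᵖₖ gᵖₖ + ∑ₖ cᵃₖ gᵃₖ` of the Lie algebra, where the passive generators are
normalised by the factors `ν`. -/
noncomputable def lieElement {n : ℕ} (ν : PassiveIndex n → ℝ) (cp : PassiveIndex n → ℝ)
    (ca : ActiveIndex n → ℝ) : PhaseMatrix n :=
  ∑ k, cp k • (ν k • passiveGenerator k) + ∑ k, ca k • activeGenerator k

/-- The two ways of turning Lie algebra elements into vector fields on the group. -/
inductive Convention : Type
  /-- left-invariant fields `g(x) = x g` -/
  | leftInvariant
  /-- right-invariant fields `g(x) = g x` -/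
  | rightInvariant

/-- The value at `x` of the invariant vector field given by `g`. -/
def Convention.field {n : ℕ} (χ : Convention) (g x : PhaseMatrix n) : PhaseMatrix n :=
  match χ with
  | .leftInvariant => x * g
  | .rightInvariant => g * x

/-- `𝒞ʳ(S)`: absolutely continuous curves `α : [0,1] → Sp(2n)` from `1` to `S` whose derivative is
bounded almost everywhere. Only the values on `[0,1]` matter. -/
structure IsAdmissibleCurve {n : ℕ} (S : PhaseMatrix n) (α : ℝ → PhaseMatrix n) : Prop where
  mem : ∀ t ∈ Icc (0 : ℝ) 1, α t ∈ Sp n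
  absolutelyContinuous : ∀ i j, AbsolutelyContinuousOnInterval (fun t => α t i j) 0 1
  bounded_deriv : ∃ M : ℝ, ∀ᵐ t ∂(volume.restrict (Icc (0 : ℝ) 1)),
    ∀ i j, |deriv (fun s => α s i j) t| ≤ M
  start : α 0 = 1
  finish : α 1 = S

/-- `cp`, `ca` are the coefficients of the velocity of `α` with respect to the passive and active
generators, at almost every time in `[0,1]`. -/
def IsGeneratedBy {n : ℕ} (χ : Convention) (ν : PassiveIndex n → ℝ) (α : ℝ → PhaseMatrix n)
    (cp : ℝ → PassiveIndex n → ℝ) (ca : ℝ → ActiveIndex n → ℝ) : Prop :=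
  ∀ᵐ t ∂(volume.restrict (Icc (0 : ℝ) 1)), ∀ i j,
    HasDerivAt (fun s => α s i j) (χ.field (lieElement ν (cp t) (ca t)) (α t) i j) t

/-- The squeezing cost `∫₀¹ ‖cᵃ(t)‖₁ dt`. -/
noncomputable def cost {n : ℕ} (ca : ℝ → ActiveIndex n → ℝ) : ℝ :=
  ∫ t in (0 : ℝ)..1, ∑ k, |ca t k|

/-- The costs of all admissible curves from `1` to `S`. -/
def costs {n : ℕ} (χ : Convention) (ν : PassiveIndex n → ℝ) (S : PhaseMatrix n) : Set ℝ :=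
  {x | ∃ (α : ℝ → PhaseMatrix n) (cp : ℝ → PassiveIndex n → ℝ) (ca : ℝ → ActiveIndex n → ℝ),
    IsAdmissibleCurve S α ∧ IsGeneratedBy χ ν α cp ca ∧ x = cost ca}

/-- `F̃(S)`: the infimum of the squeezing costs over all admissible curves from `1` to `S`. -/
noncomputable def Ftilde {n : ℕ} (χ : Convention) (ν : PassiveIndex n → ℝ) (S : PhaseMatrix n) :
    ℝ :=
  sInf (costs χ ν S)

/-- The controls run through the decomposition `S = L · diag(a, a⁻¹) · R`: only passive generators
are used in the first and in the last third of the time, and only single-mode squeezers in the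
middle third, the factors being produced in the order that the convention dictates. -/
structure ImplementsEuler {n : ℕ} (χ : Convention) (L : PhaseMatrix n) (a : Fin n → ℝ)
    (R : PhaseMatrix n) (α : ℝ → PhaseMatrix n) (cp : ℝ → PassiveIndex n → ℝ)
    (ca : ℝ → ActiveIndex n → ℝ) : Prop where
  first : α (1 / 3) = match χ with
    | .leftInvariant => L
    | .rightInvariant => R
  second : α (2 / 3) = match χ with
    | .leftInvariant => L * squeezer a
    | .rightInvariant => squeezer a * R
  passive_outside : ∀ t ∈ Icc (0 : ℝ) 1, t ∉ Icc (1 / 3 : ℝ) (2 / 3) → ca t = 0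
  squeezing_inside : ∀ t ∈ Icc (1 / 3 : ℝ) (2 / 3), cp t = 0 ∧
    (∀ p : Pairs n, p.1.1 ≠ p.1.2 → ca t (Sum.inl p) = 0) ∧ ∀ p, ca t (Sum.inr p) = 0

end Squeezing

namespace Squeezing

open MeasureTheory Set Matrix

variable {n : ℕ}

/-! ### The generators -/

/-! Lower bound: fix an Euler decomposition of `S` and let the columns of `V` be the `n` orthonormal
directions that `S` does not contract. Along a curve with `α' = g α` put `W = α V` and follow the
squared `n`-volume `det (Wᵀ W)`. Its logarithm goes from `0` to `2 F(S)`, and by Jacobi's formula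
its derivative is `2 tr (P g)`, where `P` is the orthogonal projection onto the column space of `W`.
Passive generators are antisymmetric and drop out of this trace; each active generator contributes
at most its coefficient in absolute value, because the entries of a projection satisfy `0 ≤ P_aa ≤
1` and `|P_ab| ≤ 1/2` for `a ≠ b`. Integration gives `F(S) ≤ ∫ ‖cᵃ‖₁`. This is `F_le_cost`, resting
on `abs_trace_projection_mul_lieElement_le`, `trace_inv_gram_mul_le` and `log_det_expandingFrame`.

Attainment: `K(n)` is the real form of `U(n)`, where every element is an exponential, so `L` and `R`
are exponentials of passive elements and cost nothing. The diagonal factor is the exponential of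
single-mode squeezers with coefficients `log aᵢ`, and costs `∑ |log aᵢ|`. That this equals `F(S)` is
`IsEulerDecomposition.F_eq`.

Existence of the decomposition comes from a symplectic orthonormal eigenbasis of `Sᵀ S`
(`exists_symplectic_eigenvectors`). Transposition exchanges the two conventions for the vector
fields without changing the active coefficients, so each half of the argument is needed for one
convention only. -/

lemma symUnit_transpose (i j : Fin n) : (symUnit i j)ᵀ = symUnit i j := by
  simp [symUnit, add_comm]

lemma skewUnit_transpose (i j : Fin n) : (skewUnit i j)ᵀ = -skewUnit i j := by
  simp [skewUnit]

lemma passiveGenerator_transpose (k : PassiveIndex n) :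
    (passiveGenerator k)ᵀ = -passiveGenerator k := by
  rcases k with p | p <;>
    simp [passiveGenerator, fromBlocks_transpose, symUnit_transpose, skewUnit_transpose,
      fromBlocks_neg]

lemma activeGenerator_transpose (k : ActiveIndex n) :
    (activeGenerator k)ᵀ = activeGenerator k := by
  rcases k with p | p <;>
    simp [activeGenerator, fromBlocks_transpose, symUnit_transpose]

lemma lieElement_transpose (ν cp : PassiveIndex n → ℝ) (ca : ActiveIndex n → ℝ) :
    (lieElement ν cp ca)ᵀ = lieElement ν (-cp) ca := by
  simp only [lieElement, transpose_add, transpose_sum, transpose_smul, passiveGenerator_transpose,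
    activeGenerator_transpose, Pi.neg_apply, neg_smul, smul_neg]

lemma symUnit_apply_pair (p q : Pairs n) :
    symUnit p.1.1 p.1.2 q.1.1 q.1.2 = if p = q then (if q.1.1 = q.1.2 then 2 else 1) else 0 := by
  obtain ⟨⟨a, b⟩, hab⟩ := p
  obtain ⟨⟨c, d⟩, hcd⟩ := q
  dsimp only at hab hcd
  simp only [symUnit, Matrix.add_apply, single_apply, Subtype.mk.injEq, Prod.mk.injEq]
  split_ifs <;> first | (exfalso; grind) | norm_num

lemma skewUnit_apply_pair (p q : StrictPairs n) :
    skewUnit p.1.1 p.1.2 q.1.2 q.1.1 = if p = q then 1 else 0 := by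
  obtain ⟨⟨a, b⟩, hab⟩ := p
  obtain ⟨⟨c, d⟩, hcd⟩ := q
  dsimp only at hab hcd
  simp only [skewUnit, Matrix.sub_apply, single_apply, Subtype.mk.injEq, Prod.mk.injEq]
  split_ifs <;> first | (exfalso; grind) | norm_num

lemma sum_smul_symUnit_apply (c : Pairs n → ℝ) (q : Pairs n) :
    (∑ p : Pairs n, c p • symUnit p.1.1 p.1.2) q.1.1 q.1.2 =
      c q * if q.1.1 = q.1.2 then 2 else 1 := by
  simp [Matrix.sum_apply, symUnit_apply_pair]

/-- A symmetric matrix is a combination of the matrices `E_{ij} + E_{ji}`. -/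
lemma eq_sum_smul_symUnit {Y : Matrix (Fin n) (Fin n) ℝ} (hY : Yᵀ = Y) :
    Y = ∑ p : Pairs n, (Y p.1.1 p.1.2 * if p.1.1 = p.1.2 then 1 / 2 else 1) •
      symUnit p.1.1 p.1.2 := by
  have key : ∀ i j, i ≤ j → Y i j = (∑ p : Pairs n,
      (Y p.1.1 p.1.2 * if p.1.1 = p.1.2 then 1 / 2 else 1) • symUnit p.1.1 p.1.2) i j := by
    intro i j hij
    have := sum_smul_symUnit_apply
      (fun p : Pairs n => Y p.1.1 p.1.2 * if p.1.1 = p.1.2 then 1 / 2 else 1) ⟨(i, j), hij⟩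
    rw [this]
    dsimp only
    split_ifs <;> ring
  ext i j
  rcases le_total i j with h | h
  · exact key i j h
  · have e : Y i j = Y j i := congrFun (congrFun hY j) i
    rw [e, key j i h]
    simp only [Matrix.sum_apply, Matrix.smul_apply]
    exact Finset.sum_congr rfl fun p _ => by
      rw [← congrFun (congrFun (symUnit_transpose p.1.1 p.1.2) j) i, transpose_apply]

/-- An antisymmetric matrix is a combination of the matrices `E_{ji} - E_{ij}`. -/
lemma eq_sum_smul_skewUnit {X : Matrix (Fin n) (Fin n) ℝ} (hX : Xᵀ = -X) :
    X = ∑ p : StrictPairs n, X p.1.2 p.1.1 • skewUnit p.1.1 p.1.2 := by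
  have hX' : ∀ i j, X j i = -X i j := fun i j => congrFun (congrFun hX i) j
  have key : ∀ i j, i < j → X j i = (∑ p : StrictPairs n,
      X p.1.2 p.1.1 • skewUnit p.1.1 p.1.2) j i := by
    intro i j hij
    have := fun p => skewUnit_apply_pair p (⟨(i, j), hij⟩ : StrictPairs n)
    dsimp only at this
    simp only [Matrix.sum_apply, Matrix.smul_apply, this]
    simp
  ext i j
  rcases lt_trichotomy i j with h | h | h
  · rw [hX' j i, key i j h]
    simp only [Matrix.sum_apply, Matrix.smul_apply, ← Finset.sum_neg_distrib]
    refine Finset.sum_congr rfl fun p _ => ?_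
    rw [← smul_neg]
    congr 1
    simpa using (congrFun (congrFun (skewUnit_transpose p.1.1 p.1.2) j) i).symm
  · subst h
    have h0 : X i i = 0 := by linarith [hX' i i]
    rw [h0, Matrix.sum_apply]
    refine (Finset.sum_eq_zero fun p _ => ?_).symm
    have h1 := p.2.ne
    simp only [Matrix.smul_apply, skewUnit, Matrix.sub_apply, single_apply]
    rw [if_neg fun h => h1 (h.2.trans h.1.symm), if_neg fun h => h1 (h.1.trans h.2.symm), sub_zero,
      smul_zero]
  · exact key j i h

/-- The passive generators span the matrices `[[X, Y], [-Y, X]]` with `X` antisymmetric and `Y`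
symmetric. -/
lemma exists_lieElement_passive {ν : PassiveIndex n → ℝ} (hν : ∀ k, ν k ≠ 0)
    {X Y : Matrix (Fin n) (Fin n) ℝ} (hX : Xᵀ = -X) (hY : Yᵀ = Y) :
    ∃ cp, lieElement ν cp 0 = fromBlocks X Y (-Y) X := by
  -- Division by `ν` undoes the normalisation; the factor `1 / 2` on the diagonal compensates
  -- `symUnit i i = 2 E_ii`.
  refine ⟨Sum.elim (fun p => X p.1.2 p.1.1 / ν (Sum.inl p)) (fun p =>
    (Y p.1.1 p.1.2 * if p.1.1 = p.1.2 then 1 / 2 else 1) / ν (Sum.inr p)), ?_⟩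
  have h1 : ∀ p : StrictPairs n, (X p.1.2 p.1.1 / ν (Sum.inl p)) • (ν (Sum.inl p) •
      passiveGenerator (Sum.inl p)) = X p.1.2 p.1.1 • passiveGenerator (Sum.inl p) := fun p => by
    rw [smul_smul, div_mul_cancel₀ _ (hν _)]
  have h2 : ∀ p : Pairs n, ((Y p.1.1 p.1.2 * if p.1.1 = p.1.2 then 1 / 2 else 1) /
      ν (Sum.inr p)) • (ν (Sum.inr p) • passiveGenerator (Sum.inr p)) =
      (Y p.1.1 p.1.2 * if p.1.1 = p.1.2 then 1 / 2 else 1) • passiveGenerator (Sum.inr p) :=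
    fun p => by rw [smul_smul, div_mul_cancel₀ _ (hν _)]
  simp only [lieElement, Fintype.sum_sum_type, Sum.elim_inl, Sum.elim_inr, h1, h2, Pi.zero_apply,
    zero_smul, Finset.sum_const_zero, add_zero]
  have hX' := eq_sum_smul_skewUnit hX
  have hY' := eq_sum_smul_symUnit hY
  ext i j
  rcases i with i | i <;> rcases j with j | j
  · rw [fromBlocks_apply₁₁, congrFun (congrFun hX' i) j]
    simp [-mul_ite, -ite_mul, -ite_smul, passiveGenerator, Matrix.sum_apply]
  · rw [fromBlocks_apply₁₂, congrFun (congrFun hY' i) j]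
    simp [-mul_ite, -ite_mul, -ite_smul, passiveGenerator, Matrix.sum_apply]
  · have := congrFun (congrFun hY' i) j
    simp only [fromBlocks_apply₂₁, Matrix.neg_apply]
    rw [this]
    simp [-mul_ite, -ite_mul, -ite_smul, passiveGenerator, Matrix.sum_apply]
  · rw [fromBlocks_apply₂₂, congrFun (congrFun hX' i) j]
    simp [-mul_ite, -ite_mul, -ite_smul, passiveGenerator, Matrix.sum_apply]

/-- The coefficients of a Lie algebra element with respect to the active generators. -/
noncomputable def activeCoeff (A : PhaseMatrix n) : ActiveIndex n → ℝ
  | Sum.inl p => (A + Aᵀ) (Sum.inl p.1.1) (Sum.inl p.1.2) * if p.1.1 = p.1.2 then 1 / 2 else 1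
  | Sum.inr p => (A + Aᵀ) (Sum.inl p.1.1) (Sum.inr p.1.2) * if p.1.1 = p.1.2 then 1 / 2 else 1

/-- Adding the transpose cancels the passive part and doubles the active part. The active controls
are thus a fixed linear function of the Lie algebra element, which later makes the squeezing rate
integrable. -/
lemma activeCoeff_lieElement (ν cp : PassiveIndex n → ℝ) (ca : ActiveIndex n → ℝ) :
    activeCoeff (lieElement ν cp ca) = ca := by
  have h : lieElement ν cp ca + (lieElement ν cp ca)ᵀ =
      (2 : ℝ) • ∑ k, ca k • activeGenerator k := by
    rw [lieElement_transpose, two_smul]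
    simp only [lieElement, Pi.neg_apply, neg_smul, Finset.sum_neg_distrib]
    abel
  have h' := fun a b => congrFun (congrFun h a) b
  ext k
  rcases k with p | p
  · have := sum_smul_symUnit_apply (fun q => ca (Sum.inl q)) p
    simp only [Matrix.sum_apply, Matrix.smul_apply, smul_eq_mul] at this
    simp only [activeCoeff, h', Fintype.sum_sum_type, activeGenerator, Matrix.smul_apply,
      Matrix.add_apply, Matrix.sum_apply, fromBlocks_apply₁₁, smul_eq_mul,
      mul_left_comm _ (1 / 2 : ℝ), ← Finset.mul_sum, this, Matrix.zero_apply]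
    split_ifs <;> simp
  · have := sum_smul_symUnit_apply (fun q => ca (Sum.inr q)) p
    simp only [Matrix.sum_apply, Matrix.smul_apply, smul_eq_mul] at this
    simp only [activeCoeff, h', Fintype.sum_sum_type, activeGenerator, Matrix.smul_apply,
      Matrix.add_apply, Matrix.sum_apply, fromBlocks_apply₁₂, smul_eq_mul,
      mul_left_comm _ (1 / 2 : ℝ), ← Finset.mul_sum, this, Matrix.zero_apply]
    split_ifs <;> simp

/-! ### Traces against orthogonal projections -/

section Projection

variable {m : Type*} [Fintype m] {P : Matrix m m ℝ}

lemma projection_diag_eq (hs : Pᵀ = P) (hi : P * P = P) (a : m) : P a a = ∑ b, P a b ^ 2 := by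
  conv_lhs => rw [← hi]
  rw [mul_apply]
  refine Finset.sum_congr rfl fun b _ => ?_
  rw [sq, ← congrFun (congrFun hs a) b, transpose_apply]

lemma projection_diag_nonneg (hs : Pᵀ = P) (hi : P * P = P) (a : m) : 0 ≤ P a a := by
  rw [projection_diag_eq hs hi]
  exact Finset.sum_nonneg fun _ _ => sq_nonneg _

lemma projection_diag_le_one (hs : Pᵀ = P) (hi : P * P = P) (a : m) : P a a ≤ 1 := by
  have h : P a a ^ 2 ≤ P a a := by
    conv_rhs => rw [projection_diag_eq hs hi]
    exact Finset.single_le_sum (f := fun b => P a b ^ 2) (fun _ _ => sq_nonneg _)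
      (Finset.mem_univ a)
  nlinarith

/-- Row `a` of `P = P²` gives `P_ab² ≤ P_aa (1 - P_aa) ≤ 1/4`. -/
lemma abs_projection_offDiag_le (hs : Pᵀ = P) (hi : P * P = P) {a b : m} (hab : a ≠ b) :
    |P a b| ≤ 1 / 2 := by
  have h : P a a ^ 2 + P a b ^ 2 ≤ P a a := by
    conv_rhs => rw [projection_diag_eq hs hi]
    classical
    rw [← Finset.sum_pair (f := fun b => P a b ^ 2) hab]
    exact Finset.sum_le_univ_sum_of_nonneg fun _ => sq_nonneg _
  rw [abs_le]
  constructor <;> nlinarith [sq_nonneg (P a a - 1 / 2)]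

end Projection

/-- The trace is a difference of two diagonal entries of `P` (first family, `i = j`), or a sum or
difference of two off-diagonal entries, each at most `1/2` in absolute value. This is where the
normalisation of the active generators enters. -/
lemma abs_trace_projection_mul_activeGenerator_le {P : PhaseMatrix n} (hs : Pᵀ = P)
    (hi : P * P = P) (k : ActiveIndex n) : |(P * activeGenerator k).trace| ≤ 1 := by
  have sym : ∀ a b, P a b = P b a := fun a b => congrFun (congrFun hs.symm a) b
  have tr : ∀ (i j : Fin n ⊕ Fin n) , (P * single i j 1).trace = P j i := fun i j => by
    rw [Matrix.trace_mul_single]; simp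
  have e1 : ∀ i j : Fin n, fromBlocks (symUnit i j) 0 0 (-symUnit i j) =
      single (Sum.inl i) (Sum.inl j) 1 + single (Sum.inl j) (Sum.inl i) 1 -
      single (Sum.inr i) (Sum.inr j) 1 - single (Sum.inr j) (Sum.inr i) (1 : ℝ) := by
    intro i j
    ext a b
    rcases a with a | a <;> rcases b with b | b <;> simp [symUnit, single_apply] <;> ring
  have e2 : ∀ i j : Fin n, fromBlocks 0 (symUnit i j) (symUnit i j) 0 =
      single (Sum.inl i) (Sum.inr j) 1 + single (Sum.inl j) (Sum.inr i) 1 +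
      single (Sum.inr i) (Sum.inl j) 1 + single (Sum.inr j) (Sum.inl i) (1 : ℝ) := by
    intro i j
    ext a b
    rcases a with a | a <;> rcases b with b | b <;> simp [symUnit, single_apply]
  rcases k with ⟨⟨i, j⟩, hij⟩ | ⟨⟨i, j⟩, hij⟩
  · simp only [activeGenerator, e1, Matrix.mul_smul, trace_smul, mul_add, mul_sub, trace_add,
      trace_sub, tr, smul_eq_mul]
    rw [sym (Sum.inl j), sym (Sum.inr j)]
    by_cases h : i = j
    · subst h
      have h1 := projection_diag_nonneg hs hi (Sum.inl i)
      have h2 := projection_diag_nonneg hs hi (Sum.inr i)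
      have h3 := projection_diag_le_one hs hi (Sum.inl i)
      have h4 := projection_diag_le_one hs hi (Sum.inr i)
      rw [abs_le]
      constructor <;> linarith
    · have h1 := abs_le.1 (abs_projection_offDiag_le hs hi
        (show (Sum.inl i : Fin n ⊕ Fin n) ≠ Sum.inl j by simpa using h))
      have h2 := abs_le.1 (abs_projection_offDiag_le hs hi
        (show (Sum.inr i : Fin n ⊕ Fin n) ≠ Sum.inr j by simpa using h))
      rw [abs_le]
      constructor <;> linarith
  · simp only [activeGenerator, e2, Matrix.mul_smul, trace_smul, mul_add, trace_add, tr,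
      smul_eq_mul]
    rw [sym (Sum.inr j), sym (Sum.inr i)]
    have h1 := abs_le.1 (abs_projection_offDiag_le hs hi
      (show (Sum.inl i : Fin n ⊕ Fin n) ≠ Sum.inr j by simp))
    have h2 := abs_le.1 (abs_projection_offDiag_le hs hi
      (show (Sum.inl j : Fin n ⊕ Fin n) ≠ Sum.inr i by simp))
    rw [abs_le]
    constructor <;> linarith

lemma trace_mul_eq_zero_of_symm_of_skew {m : Type*} [Fintype m] {P A : Matrix m m ℝ}
    (hP : Pᵀ = P) (hA : Aᵀ = -A) : (P * A).trace = 0 := by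
  have h : (P * A).trace = -(P * A).trace := by
    conv_lhs => rw [← trace_transpose, transpose_mul, hP, hA, trace_mul_comm]
    simp
  linarith

lemma abs_trace_projection_mul_lieElement_le {P : PhaseMatrix n} (hs : Pᵀ = P) (hi : P * P = P)
    (ν cp : PassiveIndex n → ℝ) (ca : ActiveIndex n → ℝ) :
    |(P * lieElement ν cp ca).trace| ≤ ∑ k, |ca k| := by
  simp only [lieElement, mul_add, trace_add, Matrix.mul_sum, trace_sum, Matrix.mul_smul,
    trace_smul, trace_mul_eq_zero_of_symm_of_skew hs (passiveGenerator_transpose _), smul_zero,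
    Finset.sum_const_zero, zero_add]
  refine (Finset.abs_sum_le_sum_abs _ _).trans (Finset.sum_le_sum fun k _ => ?_)
  rw [smul_eq_mul, abs_mul]
  exact mul_le_of_le_one_right (abs_nonneg _) (abs_trace_projection_mul_activeGenerator_le hs hi k)

/-! ### Sums of the largest elements of a symmetric multiset -/

/-- Negating and reversing a decreasing list gives a decreasing list again; here both have the same
multiset of entries, and a multiset has only one decreasing arrangement. -/
lemma eq_neg_rev_of_antitone {m : ℕ} {l : Fin m → ℝ} (hl : Antitone l)
    (hs : (Finset.univ.val.map l).map (fun x => -x) = Finset.univ.val.map l) (i : Fin m) :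
    l i = -l i.rev := by
  have h1 : (List.ofFn l).Pairwise (· ≥ ·) := by
    rw [List.pairwise_ofFn]
    exact fun i j hij => hl hij.le
  have h2 : (List.ofFn fun i : Fin m => -l i.rev).Pairwise (· ≥ ·) := by
    rw [List.pairwise_ofFn]
    exact fun i j hij => neg_le_neg (hl (Fin.rev_le_rev.2 hij.le))
  have e : Finset.univ.val.map (fun i : Fin m => -l i.rev) = Finset.univ.val.map l := by
    rw [← hs, Multiset.map_map]
    conv_rhs => rw [← Multiset.map_univ_val_equiv (Fin.revPerm (n := m)), Multiset.map_map]
    rfl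
  have h3 : (List.ofFn l).Perm (List.ofFn fun i : Fin m => -l i.rev) := by
    rw [← Multiset.coe_eq_coe, ← Fin.univ_val_map, ← Fin.univ_val_map, e]
  have h4 := h3.eq_of_pairwise (fun a b _ _ hab hba => le_antisymm hba hab) h1 h2
  exact congrFun (List.ofFn_injective h4) i

/-- By the symmetry `l i = -l i.rev`, the first half of the entries is nonnegative and the second
half mirrors it in absolute value. -/
lemma sum_castAdd_eq_half_sum_abs {l : Fin (n + n) → ℝ} (hl : Antitone l)
    (hs : (Finset.univ.val.map l).map (fun x => -x) = Finset.univ.val.map l) :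
    ∑ i : Fin n, l (Fin.castAdd n i) = (∑ i, |l i|) / 2 := by
  have hr := eq_neg_rev_of_antitone hl hs
  have h0 : ∀ i : Fin n, |l (Fin.castAdd n i)| = l (Fin.castAdd n i) := fun i => by
    refine abs_of_nonneg ?_
    have h1 := hr (Fin.castAdd n i)
    have h2 : l (Fin.castAdd n i).rev ≤ l (Fin.castAdd n i) := hl (by
      rw [Fin.le_def, Fin.val_rev, Fin.val_castAdd]; omega)
    linarith
  have h3 : ∑ i : Fin n, |l (Fin.natAdd n i)| = ∑ i : Fin n, |l (Fin.castAdd n i)| := by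
    refine Fintype.sum_equiv Fin.revPerm _ _ fun i => ?_
    rw [hr (Fin.natAdd n i), abs_neg]
    congr 2
    ext
    simp only [Fin.val_rev, Fin.val_natAdd, Fin.val_castAdd, Fin.revPerm_apply]
    omega
  rw [Fin.sum_univ_add, h3]
  simp only [h0]
  ring

/-! ### The value of `F` in terms of an Euler decomposition -/

lemma squeezer_eq_diagonal (a : Fin n → ℝ) :
    squeezer a = diagonal (Sum.elim a fun i => (a i)⁻¹) := by
  rw [squeezer, fromBlocks_diagonal]

lemma squeezer_transpose (a : Fin n → ℝ) : (squeezer a)ᵀ = squeezer a := by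
  rw [squeezer_eq_diagonal, diagonal_transpose]

lemma squeezer_mem_Sp {a : Fin n → ℝ} (ha : ∀ i, a i ≠ 0) : squeezer a ∈ Sp n := by
  rw [SymplecticGroup.mem_iff, squeezer_transpose, squeezer, J]
  simp [fromBlocks_multiply, ha, -fromBlocks_diagonal, ← diagonal_neg]

lemma transpose_mul_self_of_mem_K {A : PhaseMatrix n} (h : A ∈ K n) : Aᵀ * A = 1 := by
  simpa [star_eq_conjTranspose] using (mem_unitaryGroup_iff'.1 h.2)

lemma mul_transpose_self_of_mem_K {A : PhaseMatrix n} (h : A ∈ K n) : A * Aᵀ = 1 := by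
  simpa [star_eq_conjTranspose] using (mem_unitaryGroup_iff.1 h.2)

lemma IsEulerDecomposition.transpose_mul_self {S L R : PhaseMatrix n} {a : Fin n → ℝ}
    (h : IsEulerDecomposition S L a R) : Sᵀ * S = Rᵀ * (squeezer a * squeezer a) * R := by
  rw [h.eq]
  simp only [transpose_mul, squeezer_transpose, Matrix.mul_assoc]
  rw [← Matrix.mul_assoc Lᵀ, transpose_mul_self_of_mem_K h.left_mem, Matrix.one_mul]

lemma IsEulerDecomposition.charpoly {S L R : PhaseMatrix n} {a : Fin n → ℝ}
    (h : IsEulerDecomposition S L a R) : (Sᵀ * S).charpoly =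
      ∏ i, (Polynomial.X - Polynomial.C ((Sum.elim a fun i => (a i)⁻¹) i ^ 2)) := by
  rw [h.transpose_mul_self, Matrix.mul_assoc, charpoly_mul_comm, Matrix.mul_assoc,
    mul_transpose_self_of_mem_K h.right_mem, Matrix.mul_one, squeezer_eq_diagonal,
    diagonal_mul_diagonal, charpoly_diagonal]
  simp only [sq]

/-- `Sᵀ S` is orthogonally conjugate to the square of the diagonal factor, so the eigenvalues can be
compared as roots of one characteristic polynomial. Working with multisets keeps multiplicities and
avoids sorting the `aᵢ`. -/
lemma IsEulerDecomposition.map_log_singularValues {S L R : PhaseMatrix n} {a : Fin n → ℝ}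
    (h : IsEulerDecomposition S L a R) :
    Finset.univ.val.map (fun i : Fin (n + n) => Real.log ((toEuclideanLin S).singularValues i)) =
      Finset.univ.val.map (Sum.elim (fun i => Real.log (a i)) fun i => -Real.log (a i)) := by
  have hn : Module.finrank ℝ (EuclideanSpace ℝ (Fin n ⊕ Fin n)) = n + n := by simp
  set T := toEuclideanLin S with hTdef
  have hT : LinearMap.adjoint T ∘ₗ T = toEuclideanLin (Sᵀ * S) := by
    rw [hTdef, ← toEuclideanLin_conjTranspose_eq_adjoint, conjTranspose_eq_transpose_of_trivial]
    ext x
    simp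
  have hc : (LinearMap.adjoint T ∘ₗ T).charpoly = (Sᵀ * S).charpoly := by
    rw [hT, ← LinearMap.charpoly_toMatrix _ (EuclideanSpace.basisFun (Fin n ⊕ Fin n) ℝ).toBasis,
      toEuclideanLin_eq_toLin_orthonormal, LinearMap.toMatrix_toLin]
  rw [T.isSymmetric_adjoint_comp_self.charpoly_eq hn, h.charpoly] at hc
  have hr := congrArg Polynomial.roots hc
  rw [Polynomial.roots_prod _ _ (Finset.prod_ne_zero_iff.2 fun i _ => Polynomial.X_sub_C_ne_zero _),

    Polynomial.roots_prod _ _ (Finset.prod_ne_zero_iff.2 fun i _ =>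
      Polynomial.X_sub_C_ne_zero _)] at hr
  simp only [Polynomial.roots_X_sub_C, Multiset.bind_singleton] at hr
  have hm := congrArg (Multiset.map fun x => Real.log √x) hr
  rw [Multiset.map_map, Multiset.map_map] at hm
  refine (Multiset.map_congr rfl fun i _ => ?_).trans
    (hm.trans (Multiset.map_congr rfl fun i _ => ?_))
  · simp [T.singularValues_fin hn]
  · rcases i with i | i
    · simp [Real.sqrt_sq (h.pos i).le]
    · have := Real.sqrt_sq (inv_pos.2 (h.pos i)).le
      simp only [Function.comp_apply, Sum.elim_inr, this, Real.log_inv]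

/-- The squeezing measure is the sum of the absolute values of the squeezing parameters. -/
lemma IsEulerDecomposition.F_eq {S L R : PhaseMatrix n} {a : Fin n → ℝ}
    (h : IsEulerDecomposition S L a R) : F S = ∑ i, |Real.log (a i)| := by
  set l : Fin (n + n) → ℝ := fun i => Real.log ((toEuclideanLin S).singularValues i) with hl
  have hm := h.map_log_singularValues
  -- Positivity is needed to transfer the ordering through `Real.log`, which is monotone only on the
  -- positive reals and has the default value `0` at `0`.
  have hmem : ∀ i : Fin (n + n), 0 < (toEuclideanLin S).singularValues i := by
    have hn : Module.finrank ℝ (EuclideanSpace ℝ (Fin n ⊕ Fin n)) = n + n := by simp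
    have hdet : IsUnit (Sᵀ * S).det := by
      rw [h.transpose_mul_self, squeezer_eq_diagonal, diagonal_mul_diagonal, Matrix.mul_assoc,
        det_mul_comm, Matrix.mul_assoc, mul_transpose_self_of_mem_K h.right_mem, Matrix.mul_one,
        det_diagonal, isUnit_iff_ne_zero, Finset.prod_ne_zero_iff]
      rintro (i | i) - <;> simp [(h.pos i).ne']
    have hinj : Function.Injective (toEuclideanLin S) := by
      rw [← LinearMap.ker_eq_bot, LinearMap.ker_eq_bot']
      intro x hx
      have h1 : S *ᵥ x.ofLp = 0 := by simpa using congrArg WithLp.ofLp hx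
      have hS : S.det ≠ 0 := by
        rw [det_mul, isUnit_iff_ne_zero] at hdet
        exact right_ne_zero_of_mul hdet
      have := Matrix.eq_zero_of_mulVec_eq_zero hS h1
      ext i
      simp [this]
    intro i
    exact (LinearMap.injective_iff_forall_lt_finrank_singularValues_pos _).1 hinj i
      (by rw [hn]; exact i.2)
  have hanti : Antitone l := fun i j hij =>
    Real.log_le_log (hmem j) ((toEuclideanLin S).singularValues_antitone hij)
  have hs : (Finset.univ.val.map l).map (fun x => -x) = Finset.univ.val.map l := by
    rw [hm, Multiset.map_map]
    conv_rhs => rw [← Multiset.map_univ_val_equiv (Equiv.sumComm (Fin n) (Fin n)),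
      Multiset.map_map]
    refine Multiset.map_congr rfl fun i _ => ?_
    rcases i with i | i <;> simp
  have hsum : ∑ i, |l i| = 2 * ∑ i, |Real.log (a i)| := by
    have := congrArg (fun s => (s.map fun x : ℝ => |x|).sum) hm
    simp only [Multiset.map_map] at this
    change ∑ i, |l i| =
      ∑ i, |Sum.elim (fun i => Real.log (a i)) (fun i => -Real.log (a i)) i| at this
    rw [this, Fintype.sum_sum_type]
    simp [two_mul]
  have := sum_castAdd_eq_half_sum_abs hanti hs
  rw [hsum, mul_div_cancel_left₀ _ two_ne_zero] at this
  rw [← this, F, Finset.sum_range]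
  rfl

lemma squeezer_mul_squeezer (a b : Fin n → ℝ) :
    squeezer a * squeezer b = squeezer fun i => a i * b i := by
  simp [squeezer, fromBlocks_multiply, -fromBlocks_diagonal, mul_comm]

lemma squeezer_one : squeezer (fun _ : Fin n => 1) = 1 := by
  simp [squeezer]

/-! ### Existence of Euler decompositions -/

section Eigenvectors

variable {E : Type*} [NormedAddCommGroup E] [InnerProductSpace ℝ E] [FiniteDimensional ℝ E]

open scoped InnerProductSpace

/-- `T j T = j` means that `j` sends a `μ`-eigenvector to a `μ⁻¹`-eigenvector. Hence the orthogonal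
complement of all `v i` and `j (v i)` found so far is `T`-invariant, and any unit eigenvector in it
extends the family; it is orthogonal to its own image because `j` is skew. -/
lemma exists_symplectic_eigenvectors {T j : E →ₗ[ℝ] E} (hT : T.IsSymmetric)
    (hj : ∀ x y, ⟪j x, y⟫_ℝ = -⟪x, j y⟫_ℝ) (hTj : ∀ x, T (j (T x)) = j x)
    (hinj : Function.Injective T) (k : ℕ) (hk : 2 * k ≤ Module.finrank ℝ E) :
    ∃ (v : Fin k → E) (μ : Fin k → ℝ), (∀ i, T (v i) = μ i • v i) ∧
      (∀ i i', ⟪v i, v i'⟫_ℝ = if i = i' then 1 else 0) ∧ ∀ i i', ⟪v i, j (v i')⟫_ℝ = 0 := by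
  induction k with
  | zero => exact ⟨Fin.elim0, Fin.elim0, fun i => i.elim0, fun i => i.elim0, fun i => i.elim0⟩
  | succ k ih =>
    obtain ⟨v, μ, h1, h2, h3⟩ := ih (by omega)
    have hv0 : ∀ i, v i ≠ 0 := fun i h0 => by simpa [h0] using h2 i i
    have hμ : ∀ i, μ i ≠ 0 := fun i h0 => hv0 i (hinj (by rw [h1, h0, zero_smul, map_zero]))
    have hTjv : ∀ i, T (j (v i)) = (μ i)⁻¹ • j (v i) := fun i => by
      have := hTj (v i)
      rw [h1, map_smul, map_smul] at this
      conv_rhs => rw [← this, smul_smul, inv_mul_cancel₀ (hμ i), one_smul]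
    set w : Fin k ⊕ Fin k → E := Sum.elim v fun i => j (v i) with hw
    set U : Submodule ℝ E := (Submodule.span ℝ (range w))ᗮ with hU
    have memU : ∀ x, x ∈ U ↔ ∀ i, ⟪v i, x⟫_ℝ = 0 ∧ ⟪j (v i), x⟫_ℝ = 0 := by
      intro x
      rw [hU, Submodule.mem_orthogonal]
      constructor
      · exact fun h i => ⟨h _ (Submodule.subset_span ⟨Sum.inl i, rfl⟩),
          h _ (Submodule.subset_span ⟨Sum.inr i, rfl⟩)⟩
      · intro h u hu
        induction hu using Submodule.span_induction with
        | mem u hu =>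
          obtain ⟨i | i, rfl⟩ := hu
          · exact (h i).1
          · exact (h i).2
        | zero => simp
        | add u u' _ _ hu hu' => rw [inner_add_left, hu, hu', add_zero]
        | smul c u _ hu => rw [inner_smul_left, hu, mul_zero]
    have hTU : ∀ x ∈ U, T x ∈ U := by
      intro x hx
      rw [memU] at hx ⊢
      intro i
      rw [← hT, ← hT, h1, hTjv, inner_smul_left, inner_smul_left, (hx i).1, (hx i).2]
      simp
    -- The `2k` vectors in `w` cannot span a space of dimension at least `2(k + 1)`.
    have hdim : 0 < Module.finrank ℝ U := by
      have e1 := Submodule.finrank_add_finrank_orthogonal (Submodule.span ℝ (range w))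
      have e2 : Module.finrank ℝ (Submodule.span ℝ (range w)) ≤ 2 * k := by
        refine (finrank_range_le_card w).trans ?_
        simp [two_mul]
      rw [← hU] at e1
      omega
    have hTs := hT.restrict_invariant hTU
    set b := hTs.eigenvectorBasis rfl with hb
    set x : U := b ⟨0, hdim⟩ with hx
    have hxT : T (x : E) = hTs.eigenvalues rfl ⟨0, hdim⟩ • (x : E) := by
      have := hTs.apply_eigenvectorBasis rfl ⟨0, hdim⟩
      exact congrArg Subtype.val this
    have hxx : ⟪(x : E), (x : E)⟫_ℝ = 1 := by
      rw [← Submodule.coe_inner, real_inner_self_eq_norm_sq, hx, b.norm_eq_one, one_pow]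
    have hxU := (memU _).1 x.2
    have hxj : ⟪(x : E), j (x : E)⟫_ℝ = 0 := by
      have := hj x x
      rw [real_inner_comm] at this
      linarith
    refine ⟨Fin.snoc v x, Fin.snoc μ (hTs.eigenvalues rfl ⟨0, hdim⟩), ?_, ?_, ?_⟩
    · intro i
      refine Fin.lastCases ?_ (fun i => ?_) i
      · simpa using hxT
      · simpa using h1 i
    · intro i i'
      refine Fin.lastCases ?_ (fun i => ?_) i <;> refine Fin.lastCases ?_ (fun i' => ?_) i'
      · simpa using hxx
      · simpa [real_inner_comm, (Fin.castSucc_lt_last i').ne'] using (hxU i').1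
      · simpa [(Fin.castSucc_lt_last i).ne] using (hxU i).1
      · simpa using h2 i i'
    · intro i i'
      refine Fin.lastCases ?_ (fun i => ?_) i <;> refine Fin.lastCases ?_ (fun i' => ?_) i'
      · simpa using hxj
      · simpa [real_inner_comm] using (hxU i').2
      · have := hj (v i) x
        rw [(hxU i).2] at this
        simpa using this.symm
      · simpa using h3 i i'

end Eigenvectors

/-- Every symplectic matrix has an Euler decomposition. -/
lemma exists_isEulerDecomposition {S : PhaseMatrix n} (hS : S ∈ Sp n) :
    ∃ L a R, IsEulerDecomposition S L a R := by
  set A := Sᵀ * S with hA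
  have hdetA : A.det = S.det * S.det := by rw [hA, det_mul, det_transpose]
  clear_value A
  have hASp : A ∈ Sp n := hA ▸ mul_mem (SymplecticGroup.transpose_mem hS) hS
  have hAt : Aᵀ = A := by rw [hA, transpose_mul, transpose_transpose]
  -- For symmetric `A`, being symplectic is exactly the relation `T j T = j` required for the
  -- eigenvectors.
  have hAJ : A * J (Fin n) ℝ * A = J (Fin n) ℝ := by
    have := SymplecticGroup.mem_iff.1 hASp
    rwa [hAt] at this
  have inner_eq : ∀ x y : EuclideanSpace ℝ (Fin n ⊕ Fin n),
      inner ℝ x y = x.ofLp ⬝ᵥ y.ofLp := fun x y => by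
    rw [EuclideanSpace.inner_eq_star_dotProduct, dotProduct_comm]
    simp
  have hSdet : S.det ≠ 0 := (SymplecticGroup.symplectic_det hS).ne_zero
  have hT : (toEuclideanLin A).IsSymmetric := fun x y => by
    rw [inner_eq, inner_eq]
    simp only [toLpLin_apply]
    rw [dotProduct_mulVec, ← mulVec_transpose, hAt]
  have hinj : Function.Injective (toEuclideanLin A) := by
    rw [← LinearMap.ker_eq_bot, LinearMap.ker_eq_bot']
    intro x hx
    have h1 : A *ᵥ x.ofLp = 0 := by simpa using congrArg WithLp.ofLp hx
    have := Matrix.eq_zero_of_mulVec_eq_zero (by simpa [hdetA] using hSdet) h1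
    ext i
    simp [this]
  obtain ⟨v, μ, h1, h2, h3⟩ := exists_symplectic_eigenvectors hT
    (j := toEuclideanLin (J (Fin n) ℝ)) (fun x y => by
      rw [inner_eq, inner_eq]
      simp only [toLpLin_apply]
      rw [dotProduct_mulVec, ← mulVec_transpose, J_transpose, neg_mulVec, neg_dotProduct, neg_neg])
    (fun x => by simp only [toLpLin_apply, mulVec_mulVec, ← Matrix.mul_assoc, hAJ]) hinj n
    (by simp [two_mul])
  -- Each `μ i` is the squared length of `S (v i)`.
  have hμ0 : ∀ i, 0 < μ i := by
    intro i
    have e1 : μ i = (S *ᵥ (v i).ofLp) ⬝ᵥ (S *ᵥ (v i).ofLp) := by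
      have e2 : inner ℝ (v i) (toEuclideanLin A (v i)) = μ i := by
        rw [h1, inner_smul_right, h2, if_pos rfl, mul_one]
      rw [← e2, inner_eq]
      simp only [toLpLin_apply, hA]
      rw [← mulVec_mulVec, dotProduct_mulVec, vecMul_transpose]
    refine lt_of_le_of_ne ?_ fun h0 => ?_
    · rw [e1]
      exact Finset.sum_nonneg fun _ _ => mul_self_nonneg _
    · have h0' := h2 i i
      have : v i = 0 := hinj (by rw [h1, ← h0, zero_smul, map_zero])
      simp [this] at h0'
  set V : Matrix (Fin n ⊕ Fin n) (Fin n) ℝ := of fun p i => v i p with hV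
  have hVV : Vᵀ * V = 1 := by
    ext i i'
    have := h2 i i'
    rw [inner_eq] at this
    rw [one_apply, ← this]
    rfl
  have hVJ : Vᵀ * (J (Fin n) ℝ * V) = 0 := by
    ext i i'
    have := h3 i i'
    rw [inner_eq] at this
    rw [Matrix.zero_apply, ← this]
    rfl
  have hAV : A * V = V * diagonal μ := by
    ext p i
    rw [mul_diagonal]
    have := congrFun (congrArg WithLp.ofLp (h1 i)) p
    simp only [toLpLin_apply, PiLp.smul_apply, smul_eq_mul] at this
    rw [hV, of_apply, mul_comm, ← this]
    rfl
  have hAJV : A * (J (Fin n) ℝ * V) = J (Fin n) ℝ * V * diagonal fun i => (μ i)⁻¹ := by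
    have e : A * (J (Fin n) ℝ * V) * diagonal μ = J (Fin n) ℝ * V := by
      rw [Matrix.mul_assoc, Matrix.mul_assoc, ← hAV, ← Matrix.mul_assoc, ← Matrix.mul_assoc, hAJ]
    conv_rhs => rw [← e]
    rw [Matrix.mul_assoc (A * _), diagonal_mul_diagonal]
    simp [(hμ0 _).ne']
  -- The eigenvectors together with their images under `J` form an orthonormal basis. The resulting
  -- `O` commutes with `J`, so it lies in `K(n)`, and it diagonalises `A` into reciprocal pairs.
  set O : PhaseMatrix n := fromCols V (J (Fin n) ℝ * V) with hO
  have hJJ : (J (Fin n) ℝ)ᵀ * J (Fin n) ℝ = 1 := by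
    rw [J_transpose, Matrix.neg_mul, J_squared, neg_neg]
  have hOO : Oᵀ * O = 1 := by
    have e1 : (J (Fin n) ℝ * V)ᵀ * V = 0 := by
      rw [← transpose_transpose V, ← transpose_mul, transpose_transpose, hVJ, transpose_zero]
    have e2 : (J (Fin n) ℝ * V)ᵀ * (J (Fin n) ℝ * V) = 1 := by
      rw [transpose_mul, Matrix.mul_assoc, ← Matrix.mul_assoc _ _ V, hJJ, Matrix.one_mul, hVV]
    rw [hO, transpose_fromCols, fromRows_mul_fromCols, hVV, hVJ, e1, e2, fromBlocks_one]
  have hOO' : O * Oᵀ = 1 := mul_eq_one_comm.1 hOO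
  have hOJ : O * J (Fin n) ℝ = J (Fin n) ℝ * O := by
    rw [hO, mul_fromCols, ← Matrix.mul_assoc, J_squared]
    exact (fromCols_mul_fromBlocks V (J (Fin n) ℝ * V) 0 (-1) 1 0).trans (by simp)
  have hOSp : O ∈ Sp n := by
    rw [SymplecticGroup.mem_iff, hOJ, Matrix.mul_assoc, hOO', Matrix.mul_one]
  have hAO : A * O = O * squeezer μ := by
    rw [hO, mul_fromCols, hAV, hAJV, squeezer, fromCols_mul_fromBlocks]
    simp
  set a : Fin n → ℝ := fun i => √(μ i) with ha
  have ha0 : ∀ i, 0 < a i := fun i => Real.sqrt_pos.2 (hμ0 i)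
  have haa : squeezer a * squeezer a = squeezer μ := by
    rw [squeezer_mul_squeezer]
    simp [ha, Real.mul_self_sqrt (hμ0 _).le]
  have hai : squeezer a * squeezer (fun i => (a i)⁻¹) = 1 := by
    rw [squeezer_mul_squeezer, ← squeezer_one]
    simp [(ha0 _).ne']
  have hia : squeezer (fun i => (a i)⁻¹) * squeezer a = 1 := mul_eq_one_comm.1 hai
  -- With `R = Oᵀ` and `a = √μ` the left factor is forced; it is orthogonal because `Oᵀ A O` is the
  -- square of `squeezer a`.
  refine ⟨S * O * squeezer fun i => (a i)⁻¹, a, Oᵀ, ⟨?_, ?_⟩, ⟨?_, ?_⟩, ha0, ?_⟩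
  · exact mul_mem (mul_mem hS hOSp) (squeezer_mem_Sp fun i => (inv_pos.2 (ha0 i)).ne')
  · rw [mem_orthogonalGroup_iff']
    calc (S * O * squeezer fun i => (a i)⁻¹)ᵀ * (S * O * squeezer fun i => (a i)⁻¹)
        = squeezer (fun i => (a i)⁻¹) * (Oᵀ * (A * O)) * squeezer fun i => (a i)⁻¹ := by
          rw [hA]
          simp only [transpose_mul, squeezer_transpose, Matrix.mul_assoc]
      _ = 1 := by
          rw [hAO, ← Matrix.mul_assoc Oᵀ, hOO, Matrix.one_mul, ← haa, ← Matrix.mul_assoc, hia,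
            Matrix.one_mul, hai]
  · exact SymplecticGroup.transpose_mem hOSp
  · rw [mem_orthogonalGroup_iff', transpose_transpose, hOO']
  · rw [Matrix.mul_assoc _ _ (squeezer a), hia, Matrix.mul_one, Matrix.mul_assoc, hOO',
      Matrix.mul_one]

/-! ### Transposition of Euler decompositions -/

lemma IsEulerDecomposition.transpose {S L R : PhaseMatrix n} {a : Fin n → ℝ}
    (h : IsEulerDecomposition S L a R) : IsEulerDecomposition Sᵀ Rᵀ a Lᵀ where
  left_mem := ⟨SymplecticGroup.transpose_mem h.right_mem.1, by
    rw [mem_orthogonalGroup_iff', transpose_transpose, mul_transpose_self_of_mem_K h.right_mem]⟩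
  right_mem := ⟨SymplecticGroup.transpose_mem h.left_mem.1, by
    rw [mem_orthogonalGroup_iff', transpose_transpose, mul_transpose_self_of_mem_K h.left_mem]⟩
  pos := h.pos
  eq := by rw [h.eq, transpose_mul, transpose_mul, squeezer_transpose, Matrix.mul_assoc]

lemma F_transpose {S : PhaseMatrix n} (hS : S ∈ Sp n) : F Sᵀ = F S := by
  obtain ⟨L, a, R, h⟩ := exists_isEulerDecomposition hS
  rw [h.F_eq, h.transpose.F_eq]

/-! ### Entrywise calculus of matrix-valued functions -/

section Calculus

variable {l m o : Type*} [Fintype m]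

lemma hasDerivAt_mul_apply {f : ℝ → Matrix l m ℝ} {g : ℝ → Matrix m o ℝ} {f' : Matrix l m ℝ}
    {g' : Matrix m o ℝ} {t : ℝ} (hf : ∀ i j, HasDerivAt (fun s => f s i j) (f' i j) t)
    (hg : ∀ i j, HasDerivAt (fun s => g s i j) (g' i j) t) (i : l) (j : o) :
    HasDerivAt (fun s => (f s * g s) i j) ((f' * g t + f t * g') i j) t := by
  have := HasDerivAt.fun_sum (u := Finset.univ) fun k _ => (hf i k).mul (hg k j)
  simp only [mul_apply, Matrix.add_apply, ← Finset.sum_add_distrib]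
  exact this

variable [DecidableEq m]

lemma differentiable_det : Differentiable ℝ fun A : m → m → ℝ => (of A).det := by
  simp only [det_apply, of_apply]
  fun_prop

/-- On the line `A + s B` factor out `det A`: the first-order coefficient of `det (1 + s C)` is `tr
C`. Differentiability is already known, so this directional derivative determines the value on `B`.
-/
lemma fderiv_det_apply {A B : m → m → ℝ} (hdet : (of A).det ≠ 0) :
    fderiv ℝ (fun A : m → m → ℝ => (of A).det) A B =
      (of A).det * ((of A)⁻¹ * of B).trace := by
  have hline : HasDerivAt (fun s : ℝ => A + s • B) B 0 := by
    simpa using ((hasDerivAt_id (0 : ℝ)).smul_const B).const_add A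
  have h1 : HasFDerivAt (fun A : m → m → ℝ => (of A).det)
      (fderiv ℝ (fun A : m → m → ℝ => (of A).det) A) (A + (0 : ℝ) • B) := by
    rw [zero_smul, add_zero]
    exact (differentiable_det A).hasFDerivAt
  have h2 := h1.comp_hasDerivAt 0 hline
  set C := (of A)⁻¹ * of B with hC
  have hexp : ∀ s : ℝ, (of (A + s • B)).det = (of A).det *
      (1 + C.trace * s + Polynomial.eval s
        (1 + (Polynomial.X : Polynomial ℝ) • C.map Polynomial.C).det.divX.divX * s ^ 2) := by
    intro s
    rw [← det_one_add_smul, ← det_mul, mul_add, Matrix.mul_one, Matrix.mul_smul, hC,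
      ← Matrix.mul_assoc, mul_nonsing_inv _ (isUnit_iff_ne_zero.2 hdet), Matrix.one_mul]
    rfl
  have h3 : HasDerivAt (fun s : ℝ => (of (A + s • B)).det) ((of A).det * C.trace) 0 := by
    simp only [hexp]
    set p := (1 + (Polynomial.X : Polynomial ℝ) • C.map Polynomial.C).det.divX.divX
    have h := ((((hasDerivAt_id (0 : ℝ)).const_mul C.trace).const_add 1).add
      ((p.hasDerivAt 0).mul (hasDerivAt_pow 2 0))).const_mul (of A).det
    simpa using h
  exact h2.unique h3

/-- Jacobi's formula. -/
lemma hasDerivAt_det {f : ℝ → Matrix m m ℝ} {f' : Matrix m m ℝ} {t : ℝ}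
    (hf : ∀ i j, HasDerivAt (fun s => f s i j) (f' i j) t) (hdet : (f t).det ≠ 0) :
    HasDerivAt (fun s => (f s).det) ((f t).det * ((f t)⁻¹ * f').trace) t := by
  have hF : HasDerivAt (fun s => of.symm (f s)) (of.symm f') t :=
    hasDerivAt_pi.2 fun i => hasDerivAt_pi.2 fun j => hf i j
  have h1 := (differentiable_det (of.symm (f t))).hasFDerivAt.comp_hasDerivAt t hF
  rw [fderiv_det_apply (A := of.symm (f t)) hdet] at h1
  exact h1

end Calculus

/-! ### Absolutely continuous functions -/

section AbsolutelyContinuous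

variable {a b : ℝ}

lemma absolutelyContinuousOnInterval_const (c : ℝ) :
    AbsolutelyContinuousOnInterval (fun _ => c) a b :=
  (LipschitzWith.const c).lipschitzOnWith.absolutelyContinuousOnInterval

lemma absolutelyContinuousOnInterval_sum {ι : Type*} (s : Finset ι) {f : ι → ℝ → ℝ}
    (hf : ∀ i ∈ s, AbsolutelyContinuousOnInterval (f i) a b) :
    AbsolutelyContinuousOnInterval (fun t => ∑ i ∈ s, f i t) a b := by
  classical
  induction s using Finset.induction_on with
  | empty => simpa using absolutelyContinuousOnInterval_const 0
  | insert i s hi ih =>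
    simp only [Finset.sum_insert hi]
    exact (hf i (Finset.mem_insert_self i s)).add
      (ih fun j hj => hf j (Finset.mem_insert_of_mem hj))

lemma absolutelyContinuousOnInterval_prod {ι : Type*} (s : Finset ι) {f : ι → ℝ → ℝ}
    (hf : ∀ i ∈ s, AbsolutelyContinuousOnInterval (f i) a b) :
    AbsolutelyContinuousOnInterval (fun t => ∏ i ∈ s, f i t) a b := by
  classical
  induction s using Finset.induction_on with
  | empty => simpa using absolutelyContinuousOnInterval_const 1
  | insert i s hi ih =>
    simp only [Finset.prod_insert hi]
    exact (hf i (Finset.mem_insert_self i s)).mul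
      (ih fun j hj => hf j (Finset.mem_insert_of_mem hj))

lemma absolutelyContinuousOnInterval_mul_apply {l m o : Type*} [Fintype m]
    {f : ℝ → Matrix l m ℝ} {g : ℝ → Matrix m o ℝ}
    (hf : ∀ i j, AbsolutelyContinuousOnInterval (fun s => f s i j) a b)
    (hg : ∀ i j, AbsolutelyContinuousOnInterval (fun s => g s i j) a b) (i : l) (j : o) :
    AbsolutelyContinuousOnInterval (fun s => (f s * g s) i j) a b := by
  simp only [mul_apply]
  exact absolutelyContinuousOnInterval_sum _ fun k _ => (hf i k).mul (hg k j)

lemma absolutelyContinuousOnInterval_det {m : Type*} [Fintype m] [DecidableEq m]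
    {f : ℝ → Matrix m m ℝ}
    (hf : ∀ i j, AbsolutelyContinuousOnInterval (fun s => f s i j) a b) :
    AbsolutelyContinuousOnInterval (fun s => (f s).det) a b := by
  simp only [det_apply']
  exact absolutelyContinuousOnInterval_sum _ fun σ _ =>
    (absolutelyContinuousOnInterval_const _).mul
      (absolutelyContinuousOnInterval_prod _ fun i _ => hf _ _)

/-- By compactness `f` has a positive minimum `c`, and the logarithm is Lipschitz with constant
`c⁻¹` on `[c, ∞)`. -/
lemma absolutelyContinuousOnInterval_log {f : ℝ → ℝ} (hf : AbsolutelyContinuousOnInterval f a b)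
    (hpos : ∀ t ∈ uIcc a b, 0 < f t) :
    AbsolutelyContinuousOnInterval (fun t => Real.log (f t)) a b := by
  obtain ⟨t₀, ht₀, hmin⟩ := isCompact_uIcc.exists_isMinOn nonempty_uIcc hf.continuousOn
  have hc := hpos t₀ ht₀
  set c := f t₀
  have key : ∀ x y, c ≤ x → c ≤ y → Real.log x - Real.log y ≤ c⁻¹ * |x - y| := by
    intro x y hx hy
    have hx0 := hc.trans_le hx
    have hy0 := hc.trans_le hy
    rw [← Real.log_div hx0.ne' hy0.ne']
    calc Real.log (x / y) ≤ x / y - 1 := Real.log_le_sub_one_of_pos (div_pos hx0 hy0)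
      _ = y⁻¹ * (x - y) := by field_simp
      _ ≤ y⁻¹ * |x - y| := by gcongr; exact le_abs_self _
      _ ≤ c⁻¹ * |x - y| := by gcongr
  have key' : ∀ x y, c ≤ x → c ≤ y → |Real.log x - Real.log y| ≤ c⁻¹ * |x - y| := by
    intro x y hx hy
    rw [abs_le]
    constructor
    · have := key y x hy hx
      rw [abs_sub_comm] at this
      linarith
    · exact key x y hx hy
  rw [absolutelyContinuousOnInterval_iff] at hf ⊢
  intro ε hε
  obtain ⟨δ, hδ, h⟩ := hf (c * ε) (by positivity)
  refine ⟨δ, hδ, fun E hE hlt => ?_⟩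
  calc ∑ i ∈ Finset.range E.1, dist (Real.log (f (E.2 i).1)) (Real.log (f (E.2 i).2))
      ≤ ∑ i ∈ Finset.range E.1, c⁻¹ * dist (f (E.2 i).1) (f (E.2 i).2) := by
        refine Finset.sum_le_sum fun i hi => ?_
        have hm := hE.1 i hi
        simp only [Real.dist_eq]
        exact key' _ _ (hmin hm.1) (hmin hm.2)
    _ = c⁻¹ * ∑ i ∈ Finset.range E.1, dist (f (E.2 i).1) (f (E.2 i).2) := by
        rw [Finset.mul_sum]
    _ < c⁻¹ * (c * ε) := by
        gcongr
        exact h E hE hlt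
    _ = ε := by field_simp

end AbsolutelyContinuous

lemma intervalIntegrable_finset_sum {ι : Type*} [Fintype ι] {a b : ℝ} {f : ι → ℝ → ℝ}
    (hf : ∀ i, IntervalIntegrable (f i) volume a b) :
    IntervalIntegrable (fun t => ∑ i, f i t) volume a b := by
  simpa only [Finset.sum_fn] using IntervalIntegrable.sum Finset.univ fun i _ => hf i

/-! ### The lower bound -/

/-- An inverse that is polynomial in the entries, hence visibly continuous along a curve. -/
lemma symplectic_right_inv {A : PhaseMatrix n} (hA : A ∈ Sp n) :
    A * -(J (Fin n) ℝ * Aᵀ * J (Fin n) ℝ) = 1 :=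
  mul_eq_one_comm.1 (by
    have := SymplecticGroup.inv_left_mul_aux hA
    rwa [← Matrix.neg_mul] at this)

lemma IsAdmissibleCurve.continuousOn {S : PhaseMatrix n} {α : ℝ → PhaseMatrix n}
    (hα : IsAdmissibleCurve S α) : ContinuousOn α (uIcc 0 1) :=
  continuousOn_pi.2 fun i => continuousOn_pi.2 fun j => (hα.absolutelyContinuous i j).continuousOn

/-- The squeezing rate of an admissible curve is integrable. -/
lemma intervalIntegrable_sum_abs {S : PhaseMatrix n} {ν : PassiveIndex n → ℝ}
    {α : ℝ → PhaseMatrix n} {cp : ℝ → PassiveIndex n → ℝ} {ca : ℝ → ActiveIndex n → ℝ}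
    (hα : IsAdmissibleCurve S α) (hg : IsGeneratedBy .rightInvariant ν α cp ca) :
    IntervalIntegrable (fun t => ∑ k, |ca t k|) volume 0 1 := by
  -- No measurability of the controls is assumed. `X = α' α⁻¹` has integrable entries, as a
  -- derivative of an absolutely continuous curve times a continuous factor, and its active
  -- coefficients agree with `ca` almost everywhere.
  set X : ℝ → PhaseMatrix n := fun t =>
    (of fun i j => deriv (fun s => α s i j) t) * -(J (Fin n) ℝ * (α t)ᵀ * J (Fin n) ℝ) with hX
  have hXi : ∀ i j, IntervalIntegrable (fun t => X t i j) volume 0 1 := by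
    intro i j
    simp only [hX, mul_apply (m := Fin n ⊕ Fin n) (M := of _), of_apply]
    refine intervalIntegrable_finset_sum fun k => ?_
    refine (hα.absolutelyContinuous i k).intervalIntegrable_deriv.mul_continuousOn ?_
    have hc : Continuous fun A : PhaseMatrix n => (-(J (Fin n) ℝ * Aᵀ * J (Fin n) ℝ)) k j :=
      (Continuous.neg (by fun_prop)).matrix_elem k j
    exact hc.comp_continuousOn hα.continuousOn
  have hci : ∀ k, IntervalIntegrable (fun t => |activeCoeff (X t) k|) volume 0 1 := by
    rintro (p | p) <;>
    · simp only [activeCoeff, Matrix.add_apply, transpose_apply]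
      exact (((hXi _ _).add (hXi _ _)).mul_const _).abs
  have hsum : IntervalIntegrable (fun t => ∑ k, |activeCoeff (X t) k|) volume 0 1 :=
    intervalIntegrable_finset_sum hci
  refine hsum.congr_ae ?_
  rw [uIoc_of_le zero_le_one]
  have hg' := ae_mono (Measure.restrict_mono Ioc_subset_Icc_self le_rfl) hg
  filter_upwards [hg', ae_restrict_mem measurableSet_Ioc] with t ht hmem
  have hinv := symplectic_right_inv (hα.mem t (Ioc_subset_Icc_self hmem))
  have : X t = lieElement ν (cp t) (ca t) := by
    have e : (of fun i j => deriv (fun s => α s i j) t) = lieElement ν (cp t) (ca t) * α t := by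
      ext i j
      exact (ht i j).deriv
    rw [hX]
    simp only
    rw [e, Matrix.mul_assoc, hinv, Matrix.mul_one]
  rw [this, activeCoeff_lieElement]

/-- The frame spanned by the images under `Rᵀ` of the coordinate directions that
`diag(a, a⁻¹)` does not contract. -/
noncomputable def expandingFrame (a : Fin n → ℝ) (R : PhaseMatrix n) :
    Matrix (Fin n ⊕ Fin n) (Fin n) ℝ :=
  Rᵀ * (1 : PhaseMatrix n).submatrix id fun i => if 1 ≤ a i then Sum.inl i else Sum.inr i

lemma transpose_submatrix_one_mul_diagonal_mul {ι κ : Type*} [Fintype ι] [DecidableEq ι]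
    [Fintype κ] [DecidableEq κ] (d : ι → ℝ) {e : κ → ι} (he : Function.Injective e) :
    ((1 : Matrix ι ι ℝ).submatrix id e)ᵀ * diagonal d * (1 : Matrix ι ι ℝ).submatrix id e =
      diagonal (d ∘ e) := by
  rw [← submatrix_diagonal d e he]
  ext i j
  simp only [mul_apply, diagonal_apply, one_apply, submatrix_apply, transpose_apply, id]
  simp +contextual [eq_comm]

lemma injective_expanding_index (a : Fin n → ℝ) :
    Function.Injective fun i : Fin n => (if 1 ≤ a i then Sum.inl i else Sum.inr i : Fin n ⊕ Fin n) := by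
  intro i j h
  dsimp only at h
  split_ifs at h <;> simpa using h

lemma expandingFrame_transpose_mul_self (a : Fin n → ℝ) {R : PhaseMatrix n} (hR : R ∈ K n) :
    (expandingFrame a R)ᵀ * expandingFrame a R = 1 := by
  have := transpose_submatrix_one_mul_diagonal_mul (fun _ => (1 : ℝ)) (injective_expanding_index a)
  rw [diagonal_one, Matrix.mul_one] at this
  rw [expandingFrame, transpose_mul, transpose_transpose, Matrix.mul_assoc, ← Matrix.mul_assoc R,
    mul_transpose_self_of_mem_K hR, Matrix.one_mul, this]
  exact diagonal_one

/-- In this frame `Sᵀ S` is diagonal with entries `max(aᵢ, aᵢ⁻¹)²`, whose logarithms are `2 |log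
aᵢ|`. -/
lemma log_det_expandingFrame {S L R : PhaseMatrix n} {a : Fin n → ℝ}
    (h : IsEulerDecomposition S L a R) :
    Real.log ((S * expandingFrame a R)ᵀ * (S * expandingFrame a R)).det = 2 * F S := by
  have e1 : (S * expandingFrame a R)ᵀ * (S * expandingFrame a R) =
      diagonal ((fun i => Sum.elim a (fun i => (a i)⁻¹) i * Sum.elim a (fun i => (a i)⁻¹) i) ∘
        fun i => if 1 ≤ a i then Sum.inl i else Sum.inr i) := by
    rw [← transpose_submatrix_one_mul_diagonal_mul _ (injective_expanding_index a),
      ← diagonal_mul_diagonal, ← squeezer_eq_diagonal, transpose_mul, Matrix.mul_assoc,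
      ← Matrix.mul_assoc Sᵀ, h.transpose_mul_self, expandingFrame, transpose_mul,
      transpose_transpose]
    have hR := mul_transpose_self_of_mem_K h.right_mem
    set N := (1 : PhaseMatrix n).submatrix id
      (fun i : Fin n => (if 1 ≤ a i then Sum.inl i else Sum.inr i : Fin n ⊕ Fin n))
    calc Nᵀ * R * (Rᵀ * (squeezer a * squeezer a) * R * (Rᵀ * N))
        = Nᵀ * (R * Rᵀ) * (squeezer a * squeezer a) * (R * Rᵀ) * N := by
          simp only [Matrix.mul_assoc]
      _ = Nᵀ * (squeezer a * squeezer a) * N := by rw [hR, Matrix.mul_one, Matrix.mul_one]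
  have hpos : ∀ i : Fin n ⊕ Fin n, 0 < Sum.elim a (fun i => (a i)⁻¹) i := by
    rintro (i | i)
    · exact h.pos i
    · exact inv_pos.2 (h.pos i)
  rw [e1, det_diagonal, Real.log_prod, h.F_eq, Finset.mul_sum]
  swap
  · exact fun i _ => (mul_pos (hpos _) (hpos _)).ne'
  refine Finset.sum_congr rfl fun i _ => ?_
  simp only [Function.comp_apply]
  rw [Real.log_mul (hpos _).ne' (hpos _).ne', ← two_mul]
  split_ifs with hi
  · rw [abs_of_nonneg (Real.log_nonneg hi)]
    rfl
  · rw [abs_of_nonpos (Real.log_nonpos (h.pos i).le (not_le.1 hi).le), Sum.elim_inr, Real.log_inv]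

lemma det_transpose_mul_self_pos {m k : Type*} [Fintype m] [Fintype k] [DecidableEq k]
    [DecidableEq m] {W : Matrix m k ℝ} {B : Matrix k m ℝ} (h : B * W = 1) :
    0 < (Wᵀ * W).det := by
  have hinj : Function.Injective W.mulVec :=
    Function.LeftInverse.injective (g := B.mulVec) fun x => by rw [mulVec_mulVec, h, one_mulVec]
  simpa using (PosDef.conjTranspose_mul_self W hinj).det_pos

/-- By cyclicity and transposition the left side is `2 tr (P g)`, with `P = W (Wᵀ W)⁻¹ Wᵀ` the
orthogonal projection onto the column space of `W`. -/
lemma trace_inv_gram_mul_le {k : Type*} [Fintype k] [DecidableEq k]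
    {W : Matrix (Fin n ⊕ Fin n) k ℝ} (hW : (Wᵀ * W).det ≠ 0) (ν cp : PassiveIndex n → ℝ)
    (ca : ActiveIndex n → ℝ) :
    ((Wᵀ * W)⁻¹ * ((lieElement ν cp ca * W)ᵀ * W + Wᵀ * (lieElement ν cp ca * W))).trace ≤
      2 * ∑ k, |ca k| := by
  set g := lieElement ν cp ca
  set M := Wᵀ * W with hM
  have hunit : IsUnit M.det := isUnit_iff_ne_zero.2 hW
  have hMt : Mᵀ = M := by rw [hM, transpose_mul, transpose_transpose]
  have hMit : (M⁻¹)ᵀ = M⁻¹ := by rw [transpose_nonsing_inv, hMt]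
  set P := W * M⁻¹ * Wᵀ with hP
  have hPt : Pᵀ = P := by
    rw [hP, transpose_mul, transpose_mul, transpose_transpose, hMit, Matrix.mul_assoc]
  have hPP : P * P = P := by
    calc P * P = W * (M⁻¹ * M) * M⁻¹ * Wᵀ := by
          simp only [hP, hM, Matrix.mul_assoc]
      _ = P := by rw [nonsing_inv_mul _ hunit, Matrix.mul_one]
  have htr : (M⁻¹ * ((g * W)ᵀ * W + Wᵀ * (g * W))).trace = 2 * (P * g).trace := by
    have e1 : (M⁻¹ * (Wᵀ * (g * W))).trace = (P * g).trace := by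
      rw [← Matrix.mul_assoc, ← Matrix.mul_assoc, trace_mul_comm, hP]
      simp only [Matrix.mul_assoc]
    have e2 : (M⁻¹ * ((g * W)ᵀ * W)).trace = (M⁻¹ * (Wᵀ * (g * W))).trace := by
      rw [← trace_transpose, transpose_mul, hMit, trace_mul_comm, transpose_mul,
        transpose_transpose]
    rw [Matrix.mul_add, trace_add, e2, e1, two_mul]
  rw [htr]
  have := (le_abs_self _).trans (abs_trace_projection_mul_lieElement_le hPt hPP ν cp ca)
  linarith

/-- The squeezing cost of a curve with `α' = g α` is at least the squeezing measure. -/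
lemma F_le_cost {S L R : PhaseMatrix n} {a : Fin n → ℝ} {ν : PassiveIndex n → ℝ}
    {α : ℝ → PhaseMatrix n} {cp : ℝ → PassiveIndex n → ℝ} {ca : ℝ → ActiveIndex n → ℝ}
    (h : IsEulerDecomposition S L a R) (hα : IsAdmissibleCurve S α)
    (hg : IsGeneratedBy .rightInvariant ν α cp ca) : F S ≤ cost ca := by
  set V := expandingFrame a R with hV
  have hVV : Vᵀ * V = 1 := expandingFrame_transpose_mul_self a h.right_mem
  set W : ℝ → Matrix (Fin n ⊕ Fin n) (Fin n) ℝ := fun t => α t * V with hW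
  set D : ℝ → ℝ := fun t => ((W t)ᵀ * W t).det with hD
  have hpos : ∀ t ∈ Icc (0 : ℝ) 1, 0 < D t := by
    intro t ht
    have hinv := mul_eq_one_comm.1 (symplectic_right_inv (hα.mem t ht))
    refine det_transpose_mul_self_pos (B := Vᵀ * -(J (Fin n) ℝ * (α t)ᵀ * J (Fin n) ℝ)) ?_
    rw [hW, Matrix.mul_assoc, ← Matrix.mul_assoc _ (α t), hinv, Matrix.one_mul, hVV]
  have hWac : ∀ i j, AbsolutelyContinuousOnInterval (fun t => W t i j) 0 1 :=
    absolutelyContinuousOnInterval_mul_apply hα.absolutelyContinuous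
      fun i j => absolutelyContinuousOnInterval_const _
  have hDac : AbsolutelyContinuousOnInterval D 0 1 :=
    absolutelyContinuousOnInterval_det
      (absolutelyContinuousOnInterval_mul_apply (fun i j => hWac j i) hWac)
  have hlog : AbsolutelyContinuousOnInterval (fun t => Real.log (D t)) 0 1 :=
    absolutelyContinuousOnInterval_log hDac (by rwa [uIcc_of_le zero_le_one])
  have hint := hlog.integral_deriv_eq_sub
  have h0 : D 0 = 1 := by simp only [hD, hW, hα.start, Matrix.one_mul, hVV, det_one]
  have h1 : Real.log (D 1) = 2 * F S := by
    simp only [hD, hW, hα.finish]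
    exact log_det_expandingFrame h
  rw [h1, h0, Real.log_one, sub_zero] at hint
  have hmono : ∫ t in (0 : ℝ)..1, deriv (fun t => Real.log (D t)) t ≤
      ∫ t in (0 : ℝ)..1, 2 * ∑ k, |ca t k| := by
    refine intervalIntegral.integral_mono_ae_restrict zero_le_one hlog.intervalIntegrable_deriv
      ((intervalIntegrable_sum_abs hα hg).const_mul 2) ?_
    filter_upwards [hg, ae_restrict_mem measurableSet_Icc] with t ht hmem
    set g := lieElement ν (cp t) (ca t) with hgdef
    have hW' : ∀ i j, HasDerivAt (fun s => W s i j) ((g * W t) i j) t := by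
      intro i j
      have := hasDerivAt_mul_apply (g := fun _ => V) (g' := 0) ht
        (fun i j => hasDerivAt_const _ _) i j
      rwa [Matrix.mul_zero, add_zero, Convention.field, Matrix.mul_assoc] at this
    have hM' := hasDerivAt_mul_apply (f := fun s => (W s)ᵀ) (f' := (g * W t)ᵀ)
      (fun i j => hW' j i) hW'
    have hDt := hpos t hmem
    -- Taking the logarithm cancels the determinant in Jacobi's formula and leaves only the trace.
    have hlog' := (hasDerivAt_det hM' hDt.ne').log hDt.ne'
    rw [mul_div_cancel_left₀ _ hDt.ne'] at hlog'
    have hder : deriv (fun t => Real.log (D t)) t = _ := hlog'.deriv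
    rw [hder]
    exact trace_inv_gram_mul_le hDt.ne' ν (cp t) (ca t)
  rw [hint, intervalIntegral.integral_const_mul] at hmono
  rw [cost]
  linarith

/-! ### Logarithms of passive transformations -/

section ExpUnitary

open scoped Matrix.Norms.L2Operator

/-- Functional calculus with the complex logarithm. The spectrum is finite, so every function is
continuous on it and the branch cut does no harm; it lies on the unit circle, so the logarithms are
purely imaginary. -/
lemma exists_skewHermitian_exp_eq {U : Matrix (Fin n) (Fin n) ℂ}
    (hU : U ∈ unitaryGroup (Fin n) ℂ) :
    ∃ H : Matrix (Fin n) (Fin n) ℂ, Hᴴ = -H ∧ NormedSpace.exp H = U := by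
  have hn : IsStarNormal U := ⟨by
    rw [Commute, SemiconjBy, (mem_unitaryGroup_iff'.1 hU), (mem_unitaryGroup_iff.1 hU)]⟩
  have hfin : (spectrum ℂ U).Finite := by
    rw [← spectrum_toLin']
    exact Module.End.finite_spectrum _
  have hsphere : ∀ z ∈ spectrum ℂ U, ‖z‖ = 1 := fun z hz => by
    simpa using Unitary.spectrum_subset_circle (𝕜 := ℂ) (⟨U, hU⟩ : unitary _) hz
  have hcont : ∀ f : ℂ → ℂ, ContinuousOn f (spectrum ℂ U) := fun f => hfin.continuousOn f
  have hcont' : ContinuousOn Complex.exp (Complex.log '' spectrum ℂ U) :=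
    (hfin.image _).continuousOn _
  refine ⟨cfc Complex.log U, ?_, ?_⟩
  · rw [← star_eq_conjTranspose, ← cfc_star, ← cfc_neg]
    refine cfc_congr fun z hz => ?_
    have h0 : (Complex.log z).re = 0 := by rw [Complex.log_re, hsphere z hz, Real.log_one]
    apply Complex.ext <;> simp [h0]
  · rw [← CFC.complex_exp_eq_normedSpace_exp (a := cfc Complex.log U) (cfc_predicate _ _),
      ← cfc_comp Complex.exp Complex.log U hn hcont' (hcont _)]
    conv_rhs => rw [← cfc_id ℂ U]
    refine cfc_congr fun z hz => ?_
    have hz0 : z ≠ 0 := fun h0 => by simpa [h0] using hsphere z hz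
    simp [Complex.exp_log hz0]

/-- The real form `A + iB ↦ [[A, B], [-B, A]]` of a complex matrix. -/
noncomputable def realForm : Matrix (Fin n) (Fin n) ℂ →+* PhaseMatrix n where
  toFun M := fromBlocks (M.map Complex.re) (M.map Complex.im) (-M.map Complex.im)
    (M.map Complex.re)
  map_one' := by
    rw [← fromBlocks_one]
    congr 1 <;> ext i j <;> by_cases h : i = j <;> simp [one_apply, h]
  map_mul' M N := by
    rw [fromBlocks_multiply]
    congr 1 <;> ext i j <;>
      simp [mul_apply, Complex.mul_re, Complex.mul_im, Finset.sum_sub_distrib,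
        Finset.sum_add_distrib] <;> ring
  map_zero' := by
    rw [← fromBlocks_zero]
    congr 1 <;> ext i j <;> simp
  map_add' M N := by
    rw [fromBlocks_add]
    congr 1 <;> ext i j <;> simp [add_comm]

lemma realForm_apply (M : Matrix (Fin n) (Fin n) ℂ) :
    realForm M = fromBlocks (M.map Complex.re) (M.map Complex.im) (-M.map Complex.im)
      (M.map Complex.re) := rfl

lemma realForm_conjTranspose (M : Matrix (Fin n) (Fin n) ℂ) :
    realForm Mᴴ = (realForm M)ᵀ := by
  rw [realForm_apply, realForm_apply, fromBlocks_transpose]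
  congr 1 <;> ext i j <;> simp

lemma realForm_injective : Function.Injective (realForm (n := n)) := by
  intro M N h
  rw [realForm_apply, realForm_apply, fromBlocks_inj] at h
  ext i j
  exact Complex.ext (congrFun (congrFun h.1 i) j) (congrFun (congrFun h.2.1 i) j)

lemma continuous_realForm : Continuous (realForm (n := n)) := by
  refine Continuous.matrix_fromBlocks ?_ ?_ ?_ ?_
  · exact continuous_id.matrix_map Complex.continuous_re
  · exact continuous_id.matrix_map Complex.continuous_im
  · exact (continuous_id.matrix_map Complex.continuous_im).neg
  · exact continuous_id.matrix_map Complex.continuous_re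

/-- An orthogonal symplectic matrix commutes with `J`, which forces the block shape `[[A, B], [-B,
A]]`. Unitarity of `A + iB` is pulled back along the injective `realForm`. -/
lemma exists_unitary_realForm_eq {L : PhaseMatrix n} (hL : L ∈ K n) :
    ∃ U ∈ unitaryGroup (Fin n) ℂ, realForm U = L := by
  have hcomm : L * J (Fin n) ℝ = J (Fin n) ℝ * L := by
    have h1 := SymplecticGroup.mem_iff.1 hL.1
    calc L * J (Fin n) ℝ = L * J (Fin n) ℝ * (Lᵀ * L) := by
          rw [transpose_mul_self_of_mem_K hL, Matrix.mul_one]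
      _ = J (Fin n) ℝ * L := by rw [← Matrix.mul_assoc, h1]
  have hblocks := fromBlocks_toBlocks L
  rw [← hblocks, J, fromBlocks_multiply, fromBlocks_multiply, fromBlocks_inj] at hcomm
  simp only [Matrix.mul_zero, Matrix.zero_mul, Matrix.mul_one, Matrix.one_mul, Matrix.mul_neg,
    Matrix.neg_mul, zero_add, add_zero, neg_inj] at hcomm
  set U : Matrix (Fin n) (Fin n) ℂ := of fun i j => ⟨L.toBlocks₁₁ i j, L.toBlocks₁₂ i j⟩ with hU
  have hUL : realForm U = L := by
    rw [realForm_apply, ← hblocks]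
    congr 1
    · ext i j
      have := congrFun (congrFun hcomm.1 i) j
      simp only [Matrix.neg_apply] at this
      simp [hU, this]
    · ext i j
      have := congrFun (congrFun hcomm.2.1 i) j
      simp [hU, this]
  refine ⟨U, mem_unitaryGroup_iff'.2 (realForm_injective ?_), hUL⟩
  rw [map_mul, map_one, star_eq_conjTranspose, realForm_conjTranspose, hUL,
    transpose_mul_self_of_mem_K hL]

/-- Every element of `K(n)` is the exponential of a combination of passive generators. -/
lemma exists_exp_lieElement_eq_of_mem_K {ν : PassiveIndex n → ℝ} (hν : ∀ k, ν k ≠ 0)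
    {L : PhaseMatrix n} (hL : L ∈ K n) : ∃ cp, NormedSpace.exp (lieElement ν cp 0) = L := by
  obtain ⟨U, hU, rfl⟩ := exists_unitary_realForm_eq hL
  obtain ⟨H, hH, rfl⟩ := exists_skewHermitian_exp_eq hU
  have hH' : ∀ i j, star (H j i) = -H i j := fun i j => congrFun (congrFun hH i) j
  obtain ⟨cp, hcp⟩ := exists_lieElement_passive hν (X := H.map Complex.re) (Y := H.map Complex.im)
    (by
      ext i j
      simpa using congrArg Complex.re (hH' i j))
    (by
      ext i j
      simpa using congrArg Complex.im (hH' i j))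
  refine ⟨cp, ?_⟩
  rw [hcp, ← realForm_apply]
  let _ : NormedAlgebra ℚ (Matrix (Fin n) (Fin n) ℂ) := NormedAlgebra.restrictScalars ℚ ℂ _
  exact (NormedSpace.map_exp realForm continuous_realForm H).symm

/-! ### One-parameter subgroups -/

lemma hasDerivAt_exp_smul_apply (X : PhaseMatrix n) (t : ℝ) (i j : Fin n ⊕ Fin n) :
    HasDerivAt (fun s : ℝ => NormedSpace.exp (s • X) i j) ((NormedSpace.exp (t • X) * X) i j) t :=
  (LinearMap.toContinuousLinearMap (entryLinearMap ℝ ℝ i j)).hasFDerivAt.comp_hasDerivAt t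
    (hasDerivAt_exp_smul_const X t)

end ExpUnitary

/-- The hypothesis says `Xᵀ = -J⁻¹ X J`, so the transpose of `exp X` is `J⁻¹ exp(-X) J`. -/
lemma exp_mem_Sp {X : PhaseMatrix n} (hX : X * J (Fin n) ℝ + J (Fin n) ℝ * Xᵀ = 0) :
    NormedSpace.exp X ∈ Sp n := by
  have hJ := isUnit_det_J (Fin n) ℝ
  have h1 : Xᵀ = (J (Fin n) ℝ)⁻¹ * -X * J (Fin n) ℝ := by
    rw [Matrix.mul_neg, Matrix.neg_mul, Matrix.mul_assoc, eq_neg_of_add_eq_zero_left hX,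
      Matrix.mul_neg, neg_neg, ← Matrix.mul_assoc, nonsing_inv_mul _ hJ, Matrix.one_mul]
  rw [SymplecticGroup.mem_iff, ← exp_transpose, h1,
    Matrix.exp_conj' _ _ ((isUnit_iff_isUnit_det _).2 hJ), exp_neg, ← Matrix.mul_assoc,
    ← Matrix.mul_assoc, Matrix.mul_assoc _ (J (Fin n) ℝ), mul_nonsing_inv _ hJ, Matrix.mul_one,
    mul_nonsing_inv _ ((isUnit_iff_isUnit_det _).1 (Matrix.isUnit_exp X)), Matrix.one_mul]

/-- Passive generators commute with `J` and are antisymmetric; active ones anticommute with `J` and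
are symmetric. The two signs cancel in each case. -/
lemma lieElement_mul_J (ν cp : PassiveIndex n → ℝ) (ca : ActiveIndex n → ℝ) :
    lieElement ν cp ca * J (Fin n) ℝ + J (Fin n) ℝ * (lieElement ν cp ca)ᵀ = 0 := by
  have hp : ∀ k : PassiveIndex n,
      passiveGenerator k * J (Fin n) ℝ = J (Fin n) ℝ * passiveGenerator k := by
    rintro (p | p) <;> simp [passiveGenerator, J, fromBlocks_multiply]
  have ha : ∀ k : ActiveIndex n,
      activeGenerator k * J (Fin n) ℝ = -(J (Fin n) ℝ * activeGenerator k) := by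
    rintro (p | p) <;> simp [activeGenerator, J, fromBlocks_multiply, ← smul_neg, fromBlocks_neg]
  rw [lieElement_transpose]
  simp only [lieElement, Matrix.add_mul, Matrix.mul_add, Matrix.sum_mul, Matrix.mul_sum,
    Matrix.smul_mul, Matrix.mul_smul, hp, ha, Pi.neg_apply, neg_smul, smul_neg,
    Finset.sum_neg_distrib, Matrix.mul_neg]
  abel

lemma lieElement_smul (c : ℝ) (ν cp : PassiveIndex n → ℝ) (ca : ActiveIndex n → ℝ) :
    lieElement ν (c • cp) (c • ca) = c • lieElement ν cp ca := by
  simp only [lieElement, Pi.smul_apply, smul_eq_mul, mul_smul, smul_add, Finset.smul_sum]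

lemma exp_smul_lieElement_mem_Sp (s : ℝ) (ν cp : PassiveIndex n → ℝ) (ca : ActiveIndex n → ℝ) :
    NormedSpace.exp (s • lieElement ν cp ca) ∈ Sp n := by
  rw [← lieElement_smul]
  exact exp_mem_Sp (lieElement_mul_J _ _ _)

/-- The controls that produce `diag(a, a⁻¹)` in unit time. -/
noncomputable def squeezerControl (a : Fin n → ℝ) : ActiveIndex n → ℝ
  | Sum.inl p => if p.1.1 = p.1.2 then Real.log (a p.1.1) else 0
  | Sum.inr _ => 0

lemma lieElement_squeezerControl (ν : PassiveIndex n → ℝ) (a : Fin n → ℝ) :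
    lieElement ν 0 (squeezerControl a) =
      diagonal (Sum.elim (fun i => Real.log (a i)) fun i => -Real.log (a i)) := by
  have h := eq_sum_smul_symUnit (diagonal_transpose fun i => Real.log (a i))
  -- The `1 / 2` in the active generator is the same factor that the expansion in `symUnit` puts on
  -- the diagonal.
  have hc : ∀ p : Pairs n, squeezerControl a (Sum.inl p) * (1 / 2) =
      diagonal (fun i => Real.log (a i)) p.1.1 p.1.2 * if p.1.1 = p.1.2 then 1 / 2 else 1 := by
    intro p
    simp only [squeezerControl, diagonal_apply]
    split_ifs <;> simp
  rw [← fromBlocks_diagonal]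
  have hd : (diagonal fun i => -Real.log (a i)) = -diagonal fun i => Real.log (a i) :=
    (diagonal_neg _).symm
  rw [hd]
  simp only [lieElement, Pi.zero_apply, Fintype.sum_sum_type, activeGenerator, smul_smul, hc]
  simp only [squeezerControl, zero_mul, zero_smul, Finset.sum_const_zero, add_zero]
  ext i j
  have hij := fun i j => congrFun (congrFun h i) j
  rcases i with i | i <;> rcases j with j | j <;>
    simp only [Matrix.sum_apply, Matrix.smul_apply, fromBlocks_apply₁₁, fromBlocks_apply₁₂,
      fromBlocks_apply₂₁, fromBlocks_apply₂₂, Matrix.zero_apply, smul_zero,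
      Finset.sum_const_zero, Matrix.neg_apply, smul_neg, Finset.sum_neg_distrib, neg_inj, Matrix.add_apply, zero_add]
  · rw [hij, Matrix.sum_apply]
    rfl
  · rw [hij, Matrix.sum_apply]
    rfl

lemma exp_lieElement_squeezerControl (ν : PassiveIndex n → ℝ) {a : Fin n → ℝ}
    (ha : ∀ i, 0 < a i) :
    NormedSpace.exp (lieElement ν 0 (squeezerControl a)) = squeezer a := by
  rw [lieElement_squeezerControl, Matrix.exp_diagonal, squeezer_eq_diagonal]
  congr 1
  ext i
  rw [Pi.coe_exp, ← Real.exp_eq_exp_ℝ]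
  rcases i with i | i
  · simp [Real.exp_log (ha i)]
  · simp [Real.exp_neg, Real.exp_log (ha i)]

lemma sum_abs_squeezerControl (a : Fin n → ℝ) :
    ∑ k, |squeezerControl a k| = ∑ i, |Real.log (a i)| := by
  simp only [Fintype.sum_sum_type, squeezerControl, abs_zero, Finset.sum_const_zero, add_zero,
    apply_ite abs]
  rw [← Finset.sum_filter]
  refine Finset.sum_nbij' (fun p => p.1.1) (fun i => ⟨(i, i), le_rfl⟩) ?_ ?_ ?_ ?_ ?_
  · simp
  · simp
  · rintro ⟨⟨i, j⟩, hij⟩ h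
    simp only [Finset.mem_filter, Finset.mem_univ, true_and] at h
    simp [h]
  · simp
  · simp

/-! ### The curve that implements an Euler decomposition -/

/-- The clock of the `k`-th third of the unit interval: it runs from `0` to `1` during
`[k / 3, (k + 1) / 3]`. -/
noncomputable def clock (k t : ℝ) : ℝ := max 0 (min 1 (3 * t - k))

lemma clock_mem (k t : ℝ) : clock k t ∈ Icc (0 : ℝ) 1 :=
  ⟨le_max_left _ _, max_le zero_le_one (min_le_left _ _)⟩

lemma clock_of_le {k t : ℝ} (h : 3 * t ≤ k) : clock k t = 0 :=
  max_eq_left ((min_le_right _ _).trans (by linarith))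

lemma clock_of_ge {k t : ℝ} (h : k + 1 ≤ 3 * t) : clock k t = 1 := by
  rw [clock, min_eq_left (by linarith), max_eq_right zero_le_one]

lemma clock_of_mem {k t : ℝ} (h₁ : k ≤ 3 * t) (h₂ : 3 * t ≤ k + 1) : clock k t = 3 * t - k := by
  rw [clock, min_eq_right (by linarith), max_eq_right (by linarith)]

lemma lipschitzWith_clock (k : ℝ) : LipschitzWith 3 (clock k) := by
  refine LipschitzWith.const_max (LipschitzWith.const_min ?_ 1) 0
  refine LipschitzWith.of_dist_le_mul fun x y => ?_
  simp only [Real.dist_eq, NNReal.coe_ofNat]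
  rw [show 3 * x - k - (3 * y - k) = 3 * (x - y) by ring, abs_mul, abs_of_pos (by norm_num)]

/-- The one-parameter group is `C¹`, hence Lipschitz on `[0, 1]`, where the Lipschitz clock takes
its values. -/
lemma absolutelyContinuousOnInterval_exp_clock (k : ℝ) (X : PhaseMatrix n) (i j : Fin n ⊕ Fin n) :
    AbsolutelyContinuousOnInterval (fun t => NormedSpace.exp (clock k t • X) i j) 0 1 := by
  have hd := fun i j => fun t => hasDerivAt_exp_smul_apply X t i j
  have hC : ContDiff ℝ 1 fun s : ℝ => NormedSpace.exp (s • X) i j := by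
    rw [contDiff_one_iff_deriv]
    refine ⟨fun t => (hd i j t).differentiableAt, ?_⟩
    have : deriv (fun s : ℝ => NormedSpace.exp (s • X) i j) =
        fun s => (NormedSpace.exp (s • X) * X) i j := funext fun t => (hd i j t).deriv
    rw [this]
    simp only [mul_apply]
    refine continuous_finsetSum _ fun l _ => Continuous.mul ?_ continuous_const
    exact continuous_iff_continuousAt.2 fun t => (hd i l t).continuousAt
  obtain ⟨C, hL⟩ := hC.contDiffOn.exists_lipschitzOnWith one_ne_zero (convex_Icc (0 : ℝ) 1)
    isCompact_Icc
  exact (hL.comp (lipschitzWith_clock k).lipschitzOnWith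
    fun t _ => clock_mem k t).absolutelyContinuousOnInterval

/-- The curve through `1`, `exp X`, `exp X * exp Y` and `exp X * exp Y * exp Z` at the times
`0`, `1 / 3`, `2 / 3` and `1`. -/
noncomputable def concatCurve (X Y Z : PhaseMatrix n) (t : ℝ) : PhaseMatrix n :=
  NormedSpace.exp (clock 0 t • X) * NormedSpace.exp (clock 1 t • Y) *
    NormedSpace.exp (clock 2 t • Z)

/-- The velocity of `concatCurve` with respect to left-invariant fields. -/
noncomputable def concatVelocity (X Y Z : PhaseMatrix n) (t : ℝ) : PhaseMatrix n :=
  (3 : ℝ) • if t < 1 / 3 then X else if t ≤ 2 / 3 then Y else Z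

lemma hasDerivAt_mul_exp_apply (A X : PhaseMatrix n) (k t : ℝ) (i j : Fin n ⊕ Fin n) :
    HasDerivAt (fun s : ℝ => (A * NormedSpace.exp ((3 * s - k) • X)) i j)
      ((A * NormedSpace.exp ((3 * t - k) • X) * (3 : ℝ) • X) i j) t := by
  have hlin : HasDerivAt (fun s : ℝ => 3 * s - k) 3 t := by
    simpa using ((hasDerivAt_id t).const_mul 3).sub_const k
  have hX : ∀ i j, HasDerivAt (fun s : ℝ => NormedSpace.exp ((3 * s - k) • X) i j)
      (((3 : ℝ) • (NormedSpace.exp ((3 * t - k) • X) * X)) i j) t := fun i j => by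
    have := (hasDerivAt_exp_smul_apply X (3 * t - k) i j).comp t hlin
    rwa [mul_comm] at this
  have := hasDerivAt_mul_apply (f := fun _ => A) (f' := 0) (fun i j => hasDerivAt_const _ _) hX i j
  rwa [Matrix.zero_mul, zero_add, ← Matrix.mul_smul, ← Matrix.mul_assoc] at this

lemma concatCurve_of_lt (X Y Z : PhaseMatrix n) {t : ℝ} (h₀ : 0 ≤ t) (h₁ : t ≤ 1 / 3) :
    concatCurve X Y Z t = 1 * NormedSpace.exp ((3 * t - 0) • X) := by
  rw [concatCurve, clock_of_mem (by linarith) (by linarith), clock_of_le (by linarith),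
    clock_of_le (by linarith)]
  simp

lemma concatCurve_of_mem (X Y Z : PhaseMatrix n) {t : ℝ} (h₀ : 1 / 3 ≤ t) (h₁ : t ≤ 2 / 3) :
    concatCurve X Y Z t = NormedSpace.exp X * NormedSpace.exp ((3 * t - 1) • Y) := by
  rw [concatCurve, clock_of_ge (by linarith), clock_of_mem (by linarith) (by linarith),
    clock_of_le (by linarith)]
  simp

lemma concatCurve_of_gt (X Y Z : PhaseMatrix n) {t : ℝ} (h₀ : 2 / 3 ≤ t) (h₁ : t ≤ 1) :
    concatCurve X Y Z t =
      NormedSpace.exp X * NormedSpace.exp Y * NormedSpace.exp ((3 * t - 2) • Z) := by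
  rw [concatCurve, clock_of_ge (by linarith), clock_of_ge (by linarith),
    clock_of_mem (by linarith) (by linarith), one_smul, one_smul]

/-- Within each open third one factor moves and those to its right are still `1`, so the velocity
appears as a right factor. The corners at `1 / 3` and `2 / 3` are excluded. -/
lemma hasDerivAt_concatCurve (X Y Z : PhaseMatrix n) {t : ℝ} (ht : t ∈ Ioo (0 : ℝ) 1)
    (h₁ : t ≠ 1 / 3) (h₂ : t ≠ 2 / 3) (i j : Fin n ⊕ Fin n) :
    HasDerivAt (fun s => concatCurve X Y Z s i j)
      ((concatCurve X Y Z t * concatVelocity X Y Z t) i j) t := by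
  rcases lt_or_gt_of_ne h₁ with h | h
  · rw [concatVelocity, if_pos h, concatCurve_of_lt X Y Z ht.1.le h.le]
    refine (hasDerivAt_mul_exp_apply 1 X 0 t i j).congr_of_eventuallyEq ?_
    filter_upwards [Ioo_mem_nhds ht.1 h] with s hs
    rw [concatCurve_of_lt X Y Z hs.1.le hs.2.le]
  rcases lt_or_gt_of_ne h₂ with h' | h'
  · rw [concatVelocity, if_neg h.not_gt, if_pos h'.le, concatCurve_of_mem X Y Z h.le h'.le]
    refine (hasDerivAt_mul_exp_apply _ Y 1 t i j).congr_of_eventuallyEq ?_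
    filter_upwards [Ioo_mem_nhds h h'] with s hs
    rw [concatCurve_of_mem X Y Z hs.1.le hs.2.le]
  · rw [concatVelocity, if_neg h.not_gt, if_neg h'.not_ge, concatCurve_of_gt X Y Z h'.le ht.2.le]
    refine (hasDerivAt_mul_exp_apply _ Z 2 t i j).congr_of_eventuallyEq ?_
    filter_upwards [Ioo_mem_nhds h' ht.2] with s hs
    rw [concatCurve_of_gt X Y Z hs.1.le hs.2.le]

lemma ae_hasDerivAt_concatCurve (X Y Z : PhaseMatrix n) :
    ∀ᵐ t ∂(volume.restrict (Icc (0 : ℝ) 1)), ∀ i j,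
      HasDerivAt (fun s => concatCurve X Y Z s i j)
        ((concatCurve X Y Z t * concatVelocity X Y Z t) i j) t := by
  have h : ∀ c : ℝ, ∀ᵐ t ∂(volume.restrict (Icc (0 : ℝ) 1)), t ≠ c := fun c =>
    ae_restrict_of_ae (Measure.ae_ne volume c)
  filter_upwards [h 0, h 1, h (1 / 3), h (2 / 3), ae_restrict_mem measurableSet_Icc]
    with t h0 h1 h2 h3 ht
  exact hasDerivAt_concatCurve X Y Z ⟨lt_of_le_of_ne ht.1 h0.symm, lt_of_le_of_ne ht.2 h1⟩ h2 h3

lemma absolutelyContinuousOnInterval_concatCurve (X Y Z : PhaseMatrix n) (i j : Fin n ⊕ Fin n) :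
    AbsolutelyContinuousOnInterval (fun t => concatCurve X Y Z t i j) 0 1 :=
  absolutelyContinuousOnInterval_mul_apply
    (absolutelyContinuousOnInterval_mul_apply (absolutelyContinuousOnInterval_exp_clock 0 X)
      (absolutelyContinuousOnInterval_exp_clock 1 Y))
    (absolutelyContinuousOnInterval_exp_clock 2 Z) i j

lemma abs_concatVelocity_le (X Y Z : PhaseMatrix n) (t : ℝ) (i j : Fin n ⊕ Fin n) :
    |concatVelocity X Y Z t i j| ≤ 3 * (|X i j| + |Y i j| + |Z i j|) := by
  have h1 := abs_nonneg (X i j)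
  have h2 := abs_nonneg (Y i j)
  have h3 := abs_nonneg (Z i j)
  rw [concatVelocity, Matrix.smul_apply, smul_eq_mul, abs_mul, abs_of_pos (by norm_num : (0 : ℝ) < 3)]
  split_ifs <;> linarith

lemma isAdmissibleCurve_concatCurve {X Y Z : PhaseMatrix n}
    (hX : ∀ s : ℝ, NormedSpace.exp (s • X) ∈ Sp n) (hY : ∀ s : ℝ, NormedSpace.exp (s • Y) ∈ Sp n)
    (hZ : ∀ s : ℝ, NormedSpace.exp (s • Z) ∈ Sp n) :
    IsAdmissibleCurve (NormedSpace.exp X * NormedSpace.exp Y * NormedSpace.exp Z)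
      (concatCurve X Y Z) where
  mem t _ := mul_mem (mul_mem (hX _) (hY _)) (hZ _)
  absolutelyContinuous := absolutelyContinuousOnInterval_concatCurve X Y Z
  bounded_deriv := by
    -- The velocity is the curve times a piecewise constant matrix; the curve is bounded by absolute
    -- continuity.
    choose C hC using fun i j => (absolutelyContinuousOnInterval_concatCurve X Y Z i j).exists_bound
    set B : Fin n ⊕ Fin n → Fin n ⊕ Fin n → ℝ := fun i j =>
      ∑ k, C i k * (3 * (|X k j| + |Y k j| + |Z k j|)) with hB
    have hnonneg : ∀ i k, 0 ≤ C i k := fun i k =>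
      (norm_nonneg _).trans (hC i k 0 left_mem_uIcc)
    refine ⟨∑ i, ∑ j, B i j, ?_⟩
    filter_upwards [ae_hasDerivAt_concatCurve X Y Z, ae_restrict_mem measurableSet_Icc]
      with t ht hmem i j
    have hBn : ∀ i j, 0 ≤ B i j := fun i j =>
      Finset.sum_nonneg fun k _ => mul_nonneg (hnonneg i k) (by positivity)
    rw [(ht i j).deriv, mul_apply]
    calc |∑ k, concatCurve X Y Z t i k * concatVelocity X Y Z t k j|
        ≤ ∑ k, |concatCurve X Y Z t i k * concatVelocity X Y Z t k j| :=
          Finset.abs_sum_le_sum_abs _ _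
      _ ≤ B i j := by
          refine Finset.sum_le_sum fun k _ => ?_
          rw [abs_mul]
          refine mul_le_mul ?_ (abs_concatVelocity_le X Y Z t k j) (abs_nonneg _) (hnonneg i k)
          exact hC i k t (by rwa [uIcc_of_le zero_le_one])
      _ ≤ ∑ j, B i j := Finset.single_le_sum (fun j _ => hBn i j) (Finset.mem_univ j)
      _ ≤ ∑ i, ∑ j, B i j := Finset.single_le_sum (f := fun i => ∑ j, B i j)
          (fun i _ => Finset.sum_nonneg fun j _ => hBn i j) (Finset.mem_univ i)
  start := by
    rw [concatCurve_of_lt X Y Z le_rfl (by norm_num)]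
    simp
  finish := by
    rw [concatCurve_of_gt X Y Z (by norm_num) le_rfl]
    norm_num

/-- Speed `3` over a time of length `1 / 3`. -/
lemma cost_indicator (c : ActiveIndex n → ℝ) :
    cost ((Icc (1 / 3 : ℝ) (2 / 3)).indicator fun _ => (3 : ℝ) • c) = ∑ k, |c k| := by
  have h : (fun t => ∑ k, |(Icc (1 / 3 : ℝ) (2 / 3)).indicator (fun _ => (3 : ℝ) • c) t k|) =
      (Icc (1 / 3 : ℝ) (2 / 3)).indicator fun _ => 3 * ∑ k, |c k| := by
    ext t
    by_cases ht : t ∈ Icc (1 / 3 : ℝ) (2 / 3)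
    · simp only [indicator_of_mem ht, Pi.smul_apply, smul_eq_mul, abs_mul, Finset.mul_sum,
        abs_of_pos (by norm_num : (0 : ℝ) < 3)]
    · simp only [indicator_of_notMem ht, Pi.zero_apply, abs_zero, Finset.sum_const_zero]
  have hs : Ioc (0 : ℝ) 1 ∩ Icc (1 / 3) (2 / 3) = Icc (1 / 3) (2 / 3) :=
    inter_eq_right.2 fun t ht => ⟨by linarith [ht.1], by linarith [ht.2]⟩
  rw [cost, h, intervalIntegral.integral_of_le zero_le_one, setIntegral_indicator measurableSet_Icc,
    hs, setIntegral_const, Real.volume_real_Icc_of_le (by norm_num), smul_eq_mul]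
  ring

lemma exists_implementsEuler_leftInvariant {ν : PassiveIndex n → ℝ} (hν : ∀ k, ν k ≠ 0)
    {S L R : PhaseMatrix n} {a : Fin n → ℝ} (h : IsEulerDecomposition S L a R) :
    ∃ (α : ℝ → PhaseMatrix n) (cp : ℝ → PassiveIndex n → ℝ) (ca : ℝ → ActiveIndex n → ℝ),
      IsAdmissibleCurve S α ∧ IsGeneratedBy .leftInvariant ν α cp ca ∧
      ImplementsEuler .leftInvariant L a R α cp ca ∧ cost ca = F S := by
  obtain ⟨cL, hL⟩ := exists_exp_lieElement_eq_of_mem_K hν h.left_mem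
  obtain ⟨cR, hR⟩ := exists_exp_lieElement_eq_of_mem_K hν h.right_mem
  have hD := exp_lieElement_squeezerControl ν h.pos
  -- The middle third is closed: at its two end points the passive control already vanishes, as
  -- `squeezing_inside` demands.
  refine ⟨concatCurve (lieElement ν cL 0) (lieElement ν 0 (squeezerControl a))
    (lieElement ν cR 0), fun t => (3 : ℝ) • if t < 1 / 3 then cL else if t ≤ 2 / 3 then 0 else cR,
    (Icc (1 / 3 : ℝ) (2 / 3)).indicator fun _ => (3 : ℝ) • squeezerControl a, ?_, ?_, ?_, ?_⟩
  · have := isAdmissibleCurve_concatCurve (fun s => exp_smul_lieElement_mem_Sp s ν cL 0)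
      (fun s => exp_smul_lieElement_mem_Sp s ν 0 (squeezerControl a))
      (fun s => exp_smul_lieElement_mem_Sp s ν cR 0)
    rwa [hL, hD, hR, ← h.eq] at this
  · filter_upwards [ae_hasDerivAt_concatCurve (lieElement ν cL 0)
      (lieElement ν 0 (squeezerControl a)) (lieElement ν cR 0)] with t ht
    have hv : lieElement ν ((3 : ℝ) • if t < 1 / 3 then cL else if t ≤ 2 / 3 then 0 else cR)
        ((Icc (1 / 3 : ℝ) (2 / 3)).indicator (fun _ => (3 : ℝ) • squeezerControl a) t) =
        concatVelocity (lieElement ν cL 0) (lieElement ν 0 (squeezerControl a))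
          (lieElement ν cR 0) t := by
      rw [concatVelocity]
      split_ifs with h1 h2
      · rw [indicator_of_notMem (fun hm => absurd hm.1 (not_le.2 h1)), ← lieElement_smul, smul_zero]
      · have hm : t ∈ Icc (1 / 3 : ℝ) (2 / 3) := ⟨not_lt.1 h1, h2⟩
        rw [indicator_of_mem hm, ← lieElement_smul]
      · rw [indicator_of_notMem (fun hm => h2 hm.2), ← lieElement_smul, smul_zero]
    rw [hv]
    exact ht
  · refine ⟨?_, ?_, ?_, ?_⟩
    · rw [concatCurve_of_lt _ _ _ (by norm_num) le_rfl]
      norm_num [hL]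
    · rw [concatCurve_of_mem _ _ _ (by norm_num) le_rfl]
      norm_num [hL, hD]
    · exact fun t _ ht => indicator_of_notMem ht _
    · intro t ht
      simp only [indicator_of_mem ht, Pi.smul_apply, squeezerControl]
      refine ⟨?_, fun p hp => by rw [if_neg hp, smul_zero], fun p => smul_zero _⟩
      rw [if_neg (not_lt.2 ht.1), if_pos ht.2, smul_zero]
  · rw [cost_indicator, sum_abs_squeezerControl, h.F_eq]

/-! ### Exchanging the conventions by transposition -/

lemma IsAdmissibleCurve.transpose {S : PhaseMatrix n} {α : ℝ → PhaseMatrix n}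
    (h : IsAdmissibleCurve S α) : IsAdmissibleCurve Sᵀ fun t => (α t)ᵀ where
  mem t ht := SymplecticGroup.transpose_mem (h.mem t ht)
  absolutelyContinuous i j := h.absolutelyContinuous j i
  bounded_deriv := by
    obtain ⟨M, hM⟩ := h.bounded_deriv
    exact ⟨M, hM.mono fun t ht i j => ht j i⟩
  start := by rw [h.start, transpose_one]
  finish := by rw [h.finish]

/-- `(x g)ᵀ = gᵀ xᵀ`, and transposing `g` flips the passive coefficients only, so the cost is
unchanged. -/
lemma IsGeneratedBy.transpose_left {ν : PassiveIndex n → ℝ} {α : ℝ → PhaseMatrix n}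
    {cp : ℝ → PassiveIndex n → ℝ} {ca : ℝ → ActiveIndex n → ℝ}
    (h : IsGeneratedBy .leftInvariant ν α cp ca) :
    IsGeneratedBy .rightInvariant ν (fun t => (α t)ᵀ) (fun t => -cp t) ca := by
  filter_upwards [h] with t ht i j
  rw [Convention.field, ← lieElement_transpose, ← transpose_mul]
  exact ht j i

/-- The left-invariant curve for `Sᵀ = Rᵀ D Lᵀ`, with `D` the diagonal factor, starts with `Rᵀ`; its
transpose builds `R`, then `D R`, then `L D R`. -/
lemma exists_implementsEuler_rightInvariant {ν : PassiveIndex n → ℝ} (hν : ∀ k, ν k ≠ 0)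
    {S L R : PhaseMatrix n} {a : Fin n → ℝ} (hS : S ∈ Sp n) (h : IsEulerDecomposition S L a R) :
    ∃ (α : ℝ → PhaseMatrix n) (cp : ℝ → PassiveIndex n → ℝ) (ca : ℝ → ActiveIndex n → ℝ),
      IsAdmissibleCurve S α ∧ IsGeneratedBy .rightInvariant ν α cp ca ∧
      ImplementsEuler .rightInvariant L a R α cp ca ∧ cost ca = F S := by
  obtain ⟨α, cp, ca, hα, hg, hi, hc⟩ := exists_implementsEuler_leftInvariant hν h.transpose
  refine ⟨fun t => (α t)ᵀ, fun t => -cp t, ca, ?_, hg.transpose_left, ⟨?_, ?_, ?_, ?_⟩, ?_⟩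
  · simpa using hα.transpose
  · have := hi.first
    simp only at this ⊢
    rw [this, transpose_transpose]
  · have := hi.second
    simp only at this ⊢
    rw [this, transpose_mul, squeezer_transpose, transpose_transpose]
  · exact hi.passive_outside
  · intro t ht
    have := hi.squeezing_inside t ht
    exact ⟨by simp [this.1], this.2⟩
  · rw [hc, F_transpose hS]

lemma F_le_of_mem_costs {χ : Convention} {ν : PassiveIndex n → ℝ} {S : PhaseMatrix n}
    (hS : S ∈ Sp n) {x : ℝ} (hx : x ∈ costs χ ν S) : F S ≤ x := by
  obtain ⟨α, cp, ca, hα, hg, rfl⟩ := hx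
  obtain ⟨L, a, R, h⟩ := exists_isEulerDecomposition hS
  cases χ with
  | leftInvariant =>
    rw [← F_transpose hS]
    exact F_le_cost h.transpose hα.transpose hg.transpose_left
  | rightInvariant => exact F_le_cost h hα hg

end Squeezing

theorem mainTheorem3 (n : ℕ) (χ : Squeezing.Convention)
    (ν : Squeezing.PassiveIndex n → ℝ) (hν : ∀ k, ν k ≠ 0)
    (S : Squeezing.PhaseMatrix n) (hS : S ∈ Squeezing.Sp n) :
    Squeezing.Ftilde χ ν S = Squeezing.F S ∧
    IsLeast (Squeezing.costs χ ν S) (Squeezing.F S) ∧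
    (∃ (L : Squeezing.PhaseMatrix n) (a : Fin n → ℝ) (R : Squeezing.PhaseMatrix n),
      Squeezing.IsEulerDecomposition S L a R) ∧
    ∀ (L : Squeezing.PhaseMatrix n) (a : Fin n → ℝ) (R : Squeezing.PhaseMatrix n),
      Squeezing.IsEulerDecomposition S L a R →
      ∃ (α : ℝ → Squeezing.PhaseMatrix n) (cp : ℝ → Squeezing.PassiveIndex n → ℝ)
        (ca : ℝ → Squeezing.ActiveIndex n → ℝ),
        Squeezing.IsAdmissibleCurve S α ∧ Squeezing.IsGeneratedBy χ ν α cp ca ∧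
        Squeezing.ImplementsEuler χ L a R α cp ca ∧
        Squeezing.cost ca = Squeezing.F S := by
  have hcurve : ∀ (L : Squeezing.PhaseMatrix n) (a : Fin n → ℝ) (R : Squeezing.PhaseMatrix n),
      Squeezing.IsEulerDecomposition S L a R →
      ∃ (α : ℝ → Squeezing.PhaseMatrix n) (cp : ℝ → Squeezing.PassiveIndex n → ℝ)
        (ca : ℝ → Squeezing.ActiveIndex n → ℝ),
        Squeezing.IsAdmissibleCurve S α ∧ Squeezing.IsGeneratedBy χ ν α cp ca ∧
        Squeezing.ImplementsEuler χ L a R α cp ca ∧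
        Squeezing.cost ca = Squeezing.F S := by
    intro L a R h
    cases χ with
    | leftInvariant => exact Squeezing.exists_implementsEuler_leftInvariant hν h
    | rightInvariant => exact Squeezing.exists_implementsEuler_rightInvariant hν hS h
  have hEuler := Squeezing.exists_isEulerDecomposition hS
  have hleast : IsLeast (Squeezing.costs χ ν S) (Squeezing.F S) := by
    refine ⟨?_, fun x hx => Squeezing.F_le_of_mem_costs hS hx⟩
    obtain ⟨L, a, R, h⟩ := hEuler
    obtain ⟨α, cp, ca, hα, hg, -, hc⟩ := hcurve L a R h
    exact ⟨α, cp, ca, hα, hg, hc.symm⟩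
  exact ⟨hleast.csInf_eq, hleast, hEuler, hcurve⟩
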